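/- Let $N\ge 2$ be an even integer, $\tau\in(0,1)$ and $\nu>-1$. Let $$L_j^{(\nu)}(z)=\sum_{k=0}^{j}\frac{\Gamma(j+\nu+1)}{(j-k)!\,\Gamma(\nu+k+1)}\frac{(-z)^k}{k!}\quad(j\ge 0),\qquad L_{-1}^{(\nu)}=0,$$ be the generalised Laguerre polynomials, and let $$I_\mu(z)=\sum_{k\ge0}\frac{(z/2)^{2k+\mu}}{k!\,\Gamma(\mu+k+1)},\qquad K_\mu(z)=\frac{\pi}{2}\,\frac{I_{-\mu}(z)-I_\mu(z)}{\sin(\mu\pi)}\qquad (z>0)$$ be the modified Bessel functions (for integer $\mu$, $K_\mu$ is the limit in the order). Put $$p_{2j}(x)=\tau^{2j}(2j)!\,L_{2j}^{(\nu)}\!\Big(\frac x\tau\Big),\qquad p_{2j+1}(x)=-\tau^{2j+1}(2j+1)!\,L_{2j+1}^{(\nu)}\!\Big(\frac x\tau\Big)+\tau^{2j-1}(2j)!\,(2j+\nu)\,L_{2j-1}^{(\nu)}\!\Big(\frac x\tau\Big),$$ $$\Phi_j(y)=\int_{\mathbb R}\operatorname{sgn}(y-v)\,|v|^{\nu/2}K_{\nu/2}\Big(\frac{|v|}{1-\tau^2}\Big)e^{\frac{\tau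 v}{1-\tau^2}}p_j(v)\,dv,\qquad r_j=2\pi(1-\tau^2)\,\Gamma(2j+1)\,\Gamma(2j+1+\nu),$$ $$S_N(x,y)=|x|^{\nu/2}K_{\nu/2}\Big(\frac{|x|}{1-\tau^2}\Big)e^{\frac{\tau x}{1-\tau^2}}\sum_{j=0}^{N/2-1}\frac{p_{2j+1}(x)\Phi_{2j}(y)-p_{2j}(x)\Phi_{2j+1}(y)}{r_j},$$ $$\mathcal K_{M}(x,y)=\sum_{j=0}^{M-1}\frac{j!\,\tau^{2j}}{\Gamma(j+\nu+1)}L_j^{(\nu)}\!\Big(\frac x\tau\Big)L_j^{(\nu)}\!\Big(\frac y\tau\Big).$$ Then all the integrals converge absolutely and, for all real $x\neq0$ and $y\ne 0$, $$S_N(x,y)=S_{N,1}(x,y)+\widetilde S_{N,1}(x,y)+S_{N,2}(x,y),$$ where $$S_{N,1}(x,y)=\frac{|xy|^{\nu/2}}{\pi(1-\tau^2)}K_{\nu/2}\Big(\frac{|x|}{1-\tau^2}\Big)e^{\frac{\tau(x+y)}{1-\tau^2}}\Big[\tau yK_{\nu/2}\Big(\frac{|y|}{1-\tau^2}\Big)+|y|K_{\nu/2+1}\Big(\frac{|y|}{1-\tau^2}\Big)\Big]\mathcal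 K_{N-1}(x,y),$$ $$\widetilde S_{N,1}(x,y)=\frac{1}{\pi}\,y\,|xy|^{\nu/2}K_{\nu/2}\Big(\frac{|x|}{1-\tau^2}\Big)K_{\nu/2}\Big(\frac{|y|}{1-\tau^2}\Big)e^{\frac{\tau(x+y)}{1-\tau^2}}\,\partial_y\mathcal K_{N-1}(x,y),$$ $$S_{N,2}(x,y)=\frac{\tau^{2N-3}}{\pi(1-\tau^2)}\frac{(N-1)!}{\Gamma(N+\nu-1)}|x|^{\nu/2}K_{\nu/2}\Big(\frac{|x|}{1-\tau^2}\Big)e^{\frac{\tau x}{1-\tau^2}}L_{N-1}^{(\nu)}\!\Big(\frac x\tau\Big)\int_{\mathbb R}\Big(\frac12-\mathbf 1_{(-\infty,y)}(t)\Big)|t|^{\nu/2}K_{\nu/2}\Big(\frac{|t|}{1-\tau^2}\Big)e^{\frac{\tau t}{1-\tau^2}}L_{N-2}^{(\nu)}\!\Big(\frac t\tau\Big)dt.$$ For $x\ne0$ the identity also holds at $y=0$, with the right-hand side read as its limit as $y\to0$, $y\neq 0$. -/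

import Mathlib

open Filter Topology MeasureTheory

noncomputable section

namespace AsymWishart

/-- Generalised Laguerre polynomial `L_j^{(ν)}(z)`. -/
def laguerre (ν : ℝ) (j : ℕ) (z : ℝ) : ℝ :=
  ∑ k ∈ Finset.range (j + 1),
    Real.Gamma (j + ν + 1) / ((j - k).factorial * Real.Gamma (ν + k + 1))
      * ((-z) ^ k / k.factorial)

/-- Modified Bessel function of the first kind `I_μ(z)`, for `z > 0` and real order `μ`.
(`1 / Γ` vanishes at the poles of `Γ`, in agreement with Mathlib's conventions
`Γ(-n) = 0` and `a / 0 = 0`.) -/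
def besselI (μ z : ℝ) : ℝ :=
  ∑' k : ℕ, (z / 2) ^ (2 * (k : ℝ) + μ) / (k.factorial * Real.Gamma (μ + k + 1))

/-- The quotient `(π / 2) (I_{-μ}(z) - I_μ(z)) / sin (μ π)`, meaningful for non-integer `μ`. -/
def besselKQuot (μ z : ℝ) : ℝ :=
  Real.pi / 2 * ((besselI (-μ) z - besselI μ z) / Real.sin (μ * Real.pi))

open Classical in
/-- Modified Bessel function of the second kind `K_μ(z)`, for `z > 0` and real order `μ`:
the quotient above for non-integer `μ`, and its limit in the order for integer `μ`. -/
def besselK (μ z : ℝ) : ℝ :=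
  if ∃ n : ℤ, μ = n then limUnder (𝓝[≠] μ) (fun s => besselKQuot s z)
  else besselKQuot μ z

/-- `p_{2j}`. -/
def pEven (ν τ : ℝ) (j : ℕ) (x : ℝ) : ℝ :=
  τ ^ (2 * j) * (2 * j).factorial * laguerre ν (2 * j) (x / τ)

/-- `p_{2j+1}`. The second summand is absent for `j = 0`, since `L_{-1}^{(ν)} = 0`. -/
def pOdd (ν τ : ℝ) (j : ℕ) (x : ℝ) : ℝ :=
  -τ ^ (2 * j + 1) * (2 * j + 1).factorial * laguerre ν (2 * j + 1) (x / τ)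
    + if j = 0 then 0 else
        τ ^ (2 * j - 1) * (2 * j).factorial * (2 * j + ν) * laguerre ν (2 * j - 1) (x / τ)

/-- The integrand in the definition of `Φ_j(y)`, for a polynomial function `p`. -/
def phiIntegrand (ν τ : ℝ) (p : ℝ → ℝ) (y v : ℝ) : ℝ :=
  Real.sign (y - v) * |v| ^ (ν / 2) * besselK (ν / 2) (|v| / (1 - τ ^ 2))
    * Real.exp (τ * v / (1 - τ ^ 2)) * p v

/-- `Φ_{2j}(y)`. -/
def phiEven (ν τ : ℝ) (j : ℕ) (y : ℝ) : ℝ := ∫ v, phiIntegrand ν τ (pEven ν τ j) y v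

/-- `Φ_{2j+1}(y)`. -/
def phiOdd (ν τ : ℝ) (j : ℕ) (y : ℝ) : ℝ := ∫ v, phiIntegrand ν τ (pOdd ν τ j) y v

/-- The skew-norms `r_j`. -/
def skewNorm (ν τ : ℝ) (j : ℕ) : ℝ :=
  2 * Real.pi * (1 - τ ^ 2) * Real.Gamma (2 * j + 1) * Real.Gamma (2 * j + 1 + ν)

/-- The kernel `S_N(x, y)` of the real eigenvalues, for even `N`. -/
def kernelS (N : ℕ) (ν τ x y : ℝ) : ℝ :=
  |x| ^ (ν / 2) * besselK (ν / 2) (|x| / (1 - τ ^ 2)) * Real.exp (τ * x / (1 - τ ^ 2))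
    * ∑ j ∈ Finset.range (N / 2),
        (pOdd ν τ j x * phiEven ν τ j y - pEven ν τ j x * phiOdd ν τ j y) / skewNorm ν τ j

/-- The kernel `𝒦_N(x, y)` of the complex non-Hermitian Wishart ensemble. -/
def kernelC (N : ℕ) (ν τ x y : ℝ) : ℝ :=
  ∑ j ∈ Finset.range N,
    j.factorial * τ ^ (2 * j) / Real.Gamma (j + ν + 1)
      * laguerre ν j (x / τ) * laguerre ν j (y / τ)

/-- `S_{N,1}(x, y)`. -/
def kernelS1 (N : ℕ) (ν τ x y : ℝ) : ℝ :=
  1 / Real.pi * (1 / (1 - τ ^ 2)) * |x * y| ^ (ν / 2)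
    * besselK (ν / 2) (|x| / (1 - τ ^ 2)) * Real.exp (τ / (1 - τ ^ 2) * x)
    * (τ * y * besselK (ν / 2) (|y| / (1 - τ ^ 2))
        + |y| * besselK (ν / 2 + 1) (|y| / (1 - τ ^ 2)))
    * Real.exp (τ / (1 - τ ^ 2) * y)
    * kernelC (N - 1) ν τ x y

/-- `S̃_{N,1}(x, y)`. -/
def kernelS1Tilde (N : ℕ) (ν τ x y : ℝ) : ℝ :=
  1 / Real.pi * y * |x * y| ^ (ν / 2)
    * besselK (ν / 2) (|x| / (1 - τ ^ 2)) * besselK (ν / 2) (|y| / (1 - τ ^ 2))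
    * Real.exp (τ / (1 - τ ^ 2) * (x + y))
    * deriv (fun s => kernelC (N - 1) ν τ x s) y

/-- The integrand in the definition of `S_{N,2}(x, y)`. -/
def kernelS2Integrand (N : ℕ) (ν τ y t : ℝ) : ℝ :=
  (1 / 2 - (Set.Iio y).indicator (fun _ => (1 : ℝ)) t) * |t| ^ (ν / 2)
    * besselK (ν / 2) (|t| / (1 - τ ^ 2)) * Real.exp (τ / (1 - τ ^ 2) * t)
    * laguerre ν (N - 2) (t / τ)

/-- `S_{N,2}(x, y)`, for `N ≥ 2`. -/
def kernelS2 (N : ℕ) (ν τ x y : ℝ) : ℝ :=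
  1 / Real.pi * (τ ^ (2 * N - 3) / (1 - τ ^ 2))
    * ((N - 1).factorial / Real.Gamma (N + ν - 1))
    * |x| ^ (ν / 2) * besselK (ν / 2) (|x| / (1 - τ ^ 2)) * Real.exp (τ / (1 - τ ^ 2) * x)
    * laguerre ν (N - 1) (x / τ)
    * ∫ t, kernelS2Integrand N ν τ y t

end AsymWishart

end

/-! ### Macdonald's integral as a function of argument and order. -/

noncomputable section

namespace AsymWishart

/-! Put b = 1/(1-τ²) and d = τb. Up to a constant, |y|^{ν/2} K_{ν/2}(b|y|) e^{dy} is a weight W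
built from Macdonald's integral (`besselK_eq`, `weight_eq`). For every polynomial k, the function W
· `weightOp` k is the derivative, off 0, of an explicit `weightBoundary` k. The boundary term has a
two-sided limit at 0 and vanishes at ±∞, so integrating W · `weightOp` k against sgn(y - v) gives
exactly twice the boundary term (`signTransform_weightOp`).

On rescaled Laguerre polynomials `weightOp` has no diagonal part: it sends L_j to b(τ(j+1)L_{j+1} -
τ⁻¹(j+ν)L_{j-1}) (`eval_weightOp_scaledLaguerre_succ`). Applied in y to the kernel 𝒦_{N-1}, it
therefore gives a sum of antisymmetric neighbour terms L_j(x)L_{j+1}(y) - L_{j+1}(x)L_j(y), except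
for one unpaired term at the top. The antisymmetric sum is 2π times the skew-orthogonal sum behind
S_N, and the unpaired term carries L_{N-1}(x)L_{N-2}(y) (`eval_weightOp_kernelCPoly`).

Transforming this identity gives the theorem. The boundary term of 𝒦_{N-1} yields S_{N,1} from k and
S̃_{N,1} from k'; the unpaired term yields S_{N,2}. At y = 0 the claim follows because S_N is
continuous in y. -/

/-- The integrand of `macdonaldIntegral`. -/
def macdonaldKernel (μ x s : ℝ) : ℝ := s ^ (μ - 1) * Real.exp (-s - x / s)

/-- Macdonald's integral `∫_0^∞ s^{μ-1} e^{-s-x/s} ds`, equal to `2 x^{μ/2} K_μ(2√x)`. -/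
def macdonaldIntegral (μ x : ℝ) : ℝ := ∫ s in Set.Ioi (0 : ℝ), macdonaldKernel μ x s

lemma macdonaldKernel_nonneg (μ x : ℝ) {s : ℝ} (hs : 0 < s) : 0 ≤ macdonaldKernel μ x s :=
  mul_nonneg (Real.rpow_nonneg hs.le _) (Real.exp_pos _).le

lemma macdonaldIntegral_nonneg (μ x : ℝ) : 0 ≤ macdonaldIntegral μ x :=
  setIntegral_nonneg measurableSet_Ioi fun _ hs => macdonaldKernel_nonneg μ x hs

lemma measurable_macdonaldKernel (μ x : ℝ) : Measurable (macdonaldKernel μ x) := by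
  unfold macdonaldKernel
  fun_prop

lemma exp_neg_div_le {x s : ℝ} (hx : 0 < x) (hs : 0 < s) (n : ℕ) :
    Real.exp (-(x / s)) ≤ n.factorial * (s / x) ^ n := by
  have h := Real.pow_div_factorial_le_exp (x / s) (div_pos hx hs).le n
  rw [Real.exp_neg, inv_le_comm₀ (Real.exp_pos _) (by positivity)]
  refine le_trans (le_of_eq ?_) h
  rw [mul_inv, ← inv_pow, inv_div, mul_comm, ← div_eq_mul_inv]

/-- The factor e^{-x/s} absorbs any power singularity at s = 0; with n > -μ the bound is a
convergent Gamma integrand. -/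
lemma macdonaldKernel_le {x s : ℝ} (μ : ℝ) (hx : 0 < x) (hs : 0 < s) (n : ℕ) :
    macdonaldKernel μ x s ≤ n.factorial * x⁻¹ ^ n * (Real.exp (-s) * s ^ (μ + n - 1)) := by
  have h := exp_neg_div_le hx hs n
  have e : s ^ (μ + n - 1) = s ^ (μ - 1) * s ^ n := by
    rw [← Real.rpow_natCast, ← Real.rpow_add hs]; ring_nf
  rw [macdonaldKernel, sub_eq_add_neg (-s), Real.exp_add, e]
  calc s ^ (μ - 1) * (Real.exp (-s) * Real.exp (-(x / s)))
      ≤ s ^ (μ - 1) * (Real.exp (-s) * (n.factorial * (s / x) ^ n)) := by gcongr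
    _ = _ := by rw [div_eq_mul_inv, mul_pow]; ring

lemma integrableOn_macdonaldKernel (μ : ℝ) {x : ℝ} (hx : 0 < x) :
    IntegrableOn (macdonaldKernel μ x) (Set.Ioi 0) := by
  obtain ⟨n, hn⟩ := exists_nat_gt (-μ)
  refine Integrable.mono'
    ((Real.GammaIntegral_convergent (s := μ + n) (by linarith)).const_mul
      (n.factorial * x⁻¹ ^ n)) (measurable_macdonaldKernel μ x).aestronglyMeasurable ?_
  filter_upwards [ae_restrict_mem measurableSet_Ioi] with s hs
  rw [Real.norm_of_nonneg (macdonaldKernel_nonneg μ x hs)]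
  exact macdonaldKernel_le μ hx hs n

/-- Differentiating under the integral brings down -1/s, which lowers the order by one. The kernel
decreases in x, so its value at x/2 dominates near x. -/
lemma hasDerivAt_macdonaldIntegral (μ : ℝ) {x : ℝ} (hx : 0 < x) :
    HasDerivAt (macdonaldIntegral μ) (-macdonaldIntegral (μ - 1) x) x := by
  have hmem : Set.Ioi (x / 2) ∈ 𝓝 x := Ioi_mem_nhds (by linarith)
  have key := (hasDerivAt_integral_of_dominated_loc_of_deriv_le
    (μ := volume.restrict (Set.Ioi (0 : ℝ)))
    (F := macdonaldKernel μ) (F' := fun x s => -macdonaldKernel (μ - 1) x s)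
    (bound := macdonaldKernel (μ - 1) (x / 2)) hmem
    (Eventually.of_forall fun y => (measurable_macdonaldKernel μ y).aestronglyMeasurable)
    (integrableOn_macdonaldKernel μ hx)
    (measurable_macdonaldKernel (μ - 1) x).neg.aestronglyMeasurable ?_
    (integrableOn_macdonaldKernel (μ - 1) (half_pos hx)) ?_).2
  · rw [integral_neg] at key
    exact key
  · filter_upwards [ae_restrict_mem measurableSet_Ioi] with s hs y hy
    have hs' : 0 < s := hs
    have hy' : x / 2 < y := hy
    rw [norm_neg, Real.norm_of_nonneg (macdonaldKernel_nonneg _ _ hs)]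
    unfold macdonaldKernel
    gcongr
  · filter_upwards [ae_restrict_mem measurableSet_Ioi] with s hs y hy
    have hs' : 0 < s := hs
    have h := ((((hasDerivAt_id y).div_const s).const_sub (-s)).exp).const_mul (s ^ (μ - 1))
    refine h.congr_deriv ?_
    unfold macdonaldKernel
    rw [Real.rpow_sub_one hs'.ne' (μ - 1)]
    simp only [id]
    ring

/-- Integrate the derivative of s^μ e^{-s-x/s} over (0, ∞); the boundary values vanish at both ends.
-/
lemma macdonaldIntegral_recurrence (μ : ℝ) {x : ℝ} (hx : 0 < x) :
    μ * macdonaldIntegral μ x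
      = macdonaldIntegral (μ + 1) x - x * macdonaldIntegral (μ - 1) x := by
  have i0 := integrableOn_macdonaldKernel μ hx
  have i1 := integrableOn_macdonaldKernel (μ + 1) hx
  have i2 := integrableOn_macdonaldKernel (μ - 1) hx
  have hd : ∀ s ∈ Set.Ioi (0 : ℝ), μ * s ^ (μ - 1) * Real.exp (-s - x / s)
      + s ^ μ * (Real.exp (-s - x / s) * (-1 + x / s ^ 2))
      = μ * macdonaldKernel μ x s - macdonaldKernel (μ + 1) x s
        + x * macdonaldKernel (μ - 1) x s := by
    intro s hs
    have hs' : 0 < s := hs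
    unfold macdonaldKernel
    rw [Real.rpow_sub_one hs'.ne' (μ - 1), Real.rpow_sub_one hs'.ne' μ, add_sub_cancel_right]
    field_simp
    ring
  obtain ⟨n, hn⟩ := exists_nat_gt (-μ)
  have hbd : ∀ s ∈ Set.Ioi (0 : ℝ), s ^ μ * Real.exp (-s - x / s)
      ≤ n.factorial * x⁻¹ ^ n * (s ^ (μ + n) * Real.exp (-1 * s)) := by
    intro s hs
    have := macdonaldKernel_le (μ + 1) hx hs n
    rw [macdonaldKernel, add_sub_cancel_right] at this
    refine this.trans (le_of_eq ?_)
    rw [show μ + 1 + n - 1 = μ + n by ring, neg_one_mul]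
    ring
  have key := integral_Ioi_deriv_mul_eq_sub (a := 0) (a' := 0) (b' := 0)
    (u := fun s : ℝ => s ^ μ) (u' := fun s : ℝ => μ * s ^ (μ - 1))
    (v := fun s : ℝ => Real.exp (-s - x / s))
    (v' := fun s : ℝ => Real.exp (-s - x / s) * (-1 + x / s ^ 2)) ?_ ?_ ?_ ?_ ?_
  · rw [setIntegral_congr_fun measurableSet_Ioi hd, integral_add, integral_sub,
      integral_const_mul, integral_const_mul] at key
    · simp only [macdonaldIntegral]
      linarith
    · exact i0.const_mul μ
    · exact i1
    · exact (i0.const_mul μ).sub i1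
    · exact i2.const_mul x
  · exact fun s hs => Real.hasDerivAt_rpow_const (Or.inl (ne_of_gt hs))
  · intro s hs
    have hs' : 0 < s := hs
    have h := (((hasDerivAt_id s).neg.sub ((hasDerivAt_inv hs'.ne').const_mul x)).exp)
    refine h.congr_deriv ?_
    simp only [id, Pi.neg_apply, Pi.sub_apply, div_eq_mul_inv]
    ring
  · exact IntegrableOn.congr_fun (((i0.const_mul μ).sub i1).add (i2.const_mul x))
      (fun s hs => (hd s hs).symm) measurableSet_Ioi
  · refine squeeze_zero' (g := fun s => n.factorial * x⁻¹ ^ n * (s ^ (μ + n) * Real.exp (-1 * s)))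
      ?_ ?_ ?_
    · filter_upwards [self_mem_nhdsWithin] with s hs
      exact mul_nonneg (Real.rpow_nonneg (le_of_lt hs) _) (Real.exp_pos _).le
    · filter_upwards [self_mem_nhdsWithin] with s hs using hbd s hs
    · have hc : ContinuousAt
          (fun s : ℝ => n.factorial * x⁻¹ ^ n * (s ^ (μ + n) * Real.exp (-1 * s))) 0 :=
        continuousAt_const.mul ((Real.continuousAt_rpow_const 0 (μ + n)
          (Or.inr (by linarith))).mul (by fun_prop))
      have := hc.tendsto
      rw [Real.zero_rpow (by linarith)] at this
      simpa using this.mono_left nhdsWithin_le_nhds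
  · refine squeeze_zero' (g := fun s => n.factorial * x⁻¹ ^ n * (s ^ (μ + n) * Real.exp (-1 * s)))
      ?_ ?_ ?_
    · filter_upwards [eventually_gt_atTop 0] with s hs
      exact mul_nonneg (Real.rpow_nonneg (le_of_lt hs) _) (Real.exp_pos _).le
    · filter_upwards [eventually_gt_atTop 0] with s hs using hbd s hs
    · simpa using (tendsto_rpow_mul_exp_neg_mul_atTop_nhds_zero (μ + n) 1 one_pos).const_mul
        (n.factorial * x⁻¹ ^ n)

/-- Substitute s ↦ x/s, carried out as an inversion followed by a scaling. -/
lemma macdonaldIntegral_neg (μ : ℝ) {x : ℝ} (hx : 0 < x) :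
    macdonaldIntegral (-μ) x = x ^ (-μ) * macdonaldIntegral μ x := by
  have h1 := integral_comp_rpow_Ioi (macdonaldKernel (-μ) x) (p := -1) (by norm_num)
  have h2 := integral_comp_mul_left_Ioi'
    (fun t : ℝ => t ^ (-2 : ℝ) * macdonaldKernel (-μ) x t⁻¹) 0 (inv_pos.2 hx)
  rw [mul_zero] at h2
  have h3 : ∫ t in Set.Ioi (0 : ℝ), t ^ (-2 : ℝ) * macdonaldKernel (-μ) x t⁻¹
      = macdonaldIntegral (-μ) x := by
    rw [macdonaldIntegral, ← h1]
    refine setIntegral_congr_fun measurableSet_Ioi fun t ht => ?_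
    simp only [abs_neg, abs_one, one_mul, smul_eq_mul, Real.rpow_neg_one]
    norm_num
  rw [← h3, ← h2, macdonaldIntegral, smul_eq_mul, ← integral_const_mul, ← integral_const_mul]
  refine setIntegral_congr_fun measurableSet_Ioi fun t ht => ?_
  have ht' : 0 < t := ht
  simp only [macdonaldKernel]
  rw [show -(x⁻¹ * t)⁻¹ - x / (x⁻¹ * t)⁻¹ = -t - x / t by field_simp; ring,
    Real.inv_rpow (by positivity), ← Real.rpow_neg (by positivity),
    Real.mul_rpow (by positivity) ht'.le, Real.mul_rpow (by positivity) ht'.le,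
    Real.inv_rpow hx.le, Real.inv_rpow hx.le, ← Real.rpow_neg hx.le, ← Real.rpow_neg hx.le,
    ← Real.rpow_neg_one x]
  have e1 : x ^ (-μ) = x ^ (-1 : ℝ) * (x ^ (- -2 : ℝ) * x ^ (- -(-μ - 1))) := by
    rw [← Real.rpow_add hx, ← Real.rpow_add hx]; ring_nf
  have e2 : t ^ (μ - 1) = t ^ (-2 : ℝ) * t ^ (-(-μ - 1)) := by
    rw [← Real.rpow_add ht']; ring_nf
  rw [e1, e2]
  ring

/-- Needed because K of integer order is defined as a limit in the order. -/
lemma continuous_macdonaldIntegral_order {x : ℝ} (hx : 0 < x) :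
    Continuous fun μ => macdonaldIntegral μ x := by
  rw [continuous_iff_continuousAt]
  intro μ
  refine continuousAt_of_dominated
    (bound := fun s => macdonaldKernel (μ + 1) x s + macdonaldKernel (μ - 1) x s)
    (Eventually.of_forall fun m => (measurable_macdonaldKernel m x).aestronglyMeasurable) ?_
    ((integrableOn_macdonaldKernel _ hx).add (integrableOn_macdonaldKernel _ hx)) ?_
  · filter_upwards [Ioo_mem_nhds (show μ - 1 < μ by linarith) (show μ < μ + 1 by linarith)]
      with m hm
    filter_upwards [ae_restrict_mem measurableSet_Ioi] with s hs
    have hs' : 0 < s := hs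
    rw [Real.norm_of_nonneg (macdonaldKernel_nonneg _ _ hs)]
    unfold macdonaldKernel
    rw [← add_mul]
    gcongr
    rcases le_total 1 s with h | h
    · exact (Real.rpow_le_rpow_of_exponent_le h (by linarith [hm.2])).trans
        (le_add_of_nonneg_right (Real.rpow_nonneg hs'.le _))
    · exact (Real.rpow_le_rpow_of_exponent_ge hs' h (by linarith [hm.1])).trans
        (le_add_of_nonneg_left (Real.rpow_nonneg hs'.le _))
  · filter_upwards [ae_restrict_mem measurableSet_Ioi] with s hs
    have hs' : 0 < s := hs
    unfold macdonaldKernel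
    exact ((Real.continuousAt_const_rpow hs'.ne').comp (by fun_prop)).mul continuousAt_const

lemma tendsto_macdonaldIntegral_zero {μ : ℝ} (hμ : 0 < μ) :
    Tendsto (macdonaldIntegral μ) (𝓝[>] 0) (𝓝 (Real.Gamma μ)) := by
  rw [Real.Gamma_eq_integral hμ]
  refine tendsto_integral_filter_of_dominated_convergence
    (fun s => Real.exp (-s) * s ^ (μ - 1))
    (Eventually.of_forall fun x => (measurable_macdonaldKernel μ x).aestronglyMeasurable) ?_
    (Real.GammaIntegral_convergent hμ) ?_
  · filter_upwards [self_mem_nhdsWithin] with x hx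
    have hx' : 0 < x := hx
    filter_upwards [ae_restrict_mem measurableSet_Ioi] with s hs
    rw [Real.norm_of_nonneg (macdonaldKernel_nonneg _ _ hs)]
    simpa using macdonaldKernel_le μ hx' hs 0
  · filter_upwards [ae_restrict_mem measurableSet_Ioi] with s hs
    have hs' : 0 < s := hs
    have : Continuous fun x : ℝ => macdonaldKernel μ x s := by
      unfold macdonaldKernel; fun_prop
    have h := (this.tendsto 0).mono_left (nhdsWithin_le_nhds (s := Set.Ioi 0))
    simpa [macdonaldKernel, mul_comm] using h

/-- Joint control of `macdonaldIntegral` at `0` and at `∞`. -/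
lemma exists_macdonaldIntegral_le {μ a θ : ℝ} (ha : 0 ≤ a) (ha1 : a ≤ 1) (hμ : 0 < μ + a)
    (hθ0 : 0 ≤ θ) (hθ : θ < 1) :
    ∃ C, 0 ≤ C ∧ ∀ x, 0 < x →
      macdonaldIntegral μ x ≤ C * (x ^ (-a) * Real.exp (-(θ * (2 * √x)))) := by
  have hδ : 0 < 1 - θ := by linarith
  have hint : IntegrableOn (fun s : ℝ => s ^ (μ + a - 1) * Real.exp (-(1 - θ) * s)) (Set.Ioi 0) := by
    have := integrableOn_rpow_mul_exp_neg_mul_rpow (p := 1) (s := μ + a - 1) (by linarith)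
      one_pos hδ
    simpa using this
  set D := ∫ s in Set.Ioi (0 : ℝ), s ^ (μ + a - 1) * Real.exp (-(1 - θ) * s)
  have hD : 0 ≤ D := setIntegral_nonneg measurableSet_Ioi fun s hs =>
    mul_nonneg (Real.rpow_nonneg (le_of_lt hs) _) (Real.exp_pos _).le
  refine ⟨(1 - θ) ^ (-a) * D, by positivity, fun x hx => ?_⟩
  -- The exponent s + x/s ≥ 2√x is split: a fraction θ gives the decay in √x. Of the remaining 1 -
  -- θ, the part in s keeps the integral convergent, and the part in x/s is traded for the power
  -- x^{-a} s^a.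
  have hle : ∀ s ∈ Set.Ioi (0 : ℝ), macdonaldKernel μ x s
      ≤ (1 - θ) ^ (-a) * (x ^ (-a) * Real.exp (-(θ * (2 * √x))))
        * (s ^ (μ + a - 1) * Real.exp (-(1 - θ) * s)) := by
    intro s hs
    have hs' : 0 < s := hs
    have h1 : 2 * √x ≤ s + x / s := by
      have e : x / s = (√x) ^ 2 / s := by rw [Real.sq_sqrt hx.le]
      rw [e, ← sub_nonneg]
      have : s + √x ^ 2 / s - 2 * √x = (s - √x) ^ 2 / s := by field_simp; ring
      rw [this]; positivity
    set t := (1 - θ) * x / s with ht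
    have ht0 : 0 < t := by positivity
    have h2 : t ^ a ≤ Real.exp t := by
      rcases le_total t 1 with h | h
      · exact (Real.rpow_le_one ht0.le h ha).trans (Real.one_le_exp ht0.le)
      · calc t ^ a ≤ t ^ (1 : ℝ) := Real.rpow_le_rpow_of_exponent_le h ha1
          _ = t := Real.rpow_one t
          _ ≤ Real.exp t := by linarith [Real.add_one_le_exp t]
    have h3 : Real.exp (-t) ≤ t ^ (-a) := by
      rw [Real.exp_neg, Real.rpow_neg ht0.le]
      exact inv_anti₀ (Real.rpow_pos_of_pos ht0 a) h2
    have h4 : t ^ (-a) = (1 - θ) ^ (-a) * x ^ (-a) * s ^ a := by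
      rw [ht, Real.div_rpow (by positivity) hs'.le, Real.mul_rpow hδ.le hx.le,
        Real.rpow_neg hs'.le a, div_inv_eq_mul]
    have h5 : s ^ (μ + a - 1) = s ^ (μ - 1) * s ^ a := by
      rw [← Real.rpow_add hs']; ring_nf
    have h6 : Real.exp (-s - x / s)
        ≤ Real.exp (-(θ * (2 * √x))) * Real.exp (-(1 - θ) * s) * Real.exp (-t) := by
      rw [← Real.exp_add, ← Real.exp_add]
      refine Real.exp_le_exp.2 ?_
      have e : t = (1 - θ) * (x / s) := by rw [ht]; ring
      rw [e]
      nlinarith [mul_le_mul_of_nonneg_left h1 hθ0]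
    calc macdonaldKernel μ x s
        ≤ s ^ (μ - 1) * (Real.exp (-(θ * (2 * √x))) * Real.exp (-(1 - θ) * s) * t ^ (-a)) := by
          unfold macdonaldKernel
          refine mul_le_mul_of_nonneg_left (h6.trans ?_) (Real.rpow_nonneg hs'.le _)
          gcongr
      _ = _ := by rw [h4, h5]; ring
  calc macdonaldIntegral μ x
      ≤ ∫ s in Set.Ioi (0 : ℝ), (1 - θ) ^ (-a) * (x ^ (-a) * Real.exp (-(θ * (2 * √x))))
        * (s ^ (μ + a - 1) * Real.exp (-(1 - θ) * s)) :=
        setIntegral_mono_on (integrableOn_macdonaldKernel μ hx) (hint.const_mul _)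
          measurableSet_Ioi hle
    _ = _ := by rw [integral_const_mul]; ring

end AsymWishart

end

/-! ### Frobenius series and the identification of K with Macdonald's integral. -/

noncomputable section

namespace AsymWishart

/-- The entire function `∑ x^k / (k! Γ(μ+k+1))`, equal to `x^{-μ/2} I_μ(2√x)`. -/
def besselEntire (μ x : ℝ) : ℝ := ∑' k : ℕ, x ^ k / (k.factorial * Real.Gamma (μ + k + 1))

/-- Γ ≥ 1 on [2, ∞), so only finitely many k remain; at the poles the inverse is 0 by convention. -/
lemma exists_inv_Gamma_le (μ : ℝ) : ∃ M, ∀ k : ℕ, |(Real.Gamma (μ + k + 1))⁻¹| ≤ M := by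
  have h : IsBoundedUnder (· ≤ ·) atTop fun k : ℕ => |(Real.Gamma (μ + k + 1))⁻¹| := by
    refine ⟨1, ?_⟩
    rw [eventually_map]
    obtain ⟨n, hn⟩ := exists_nat_gt (1 - μ)
    filter_upwards [eventually_ge_atTop n] with k hk
    have hk' : (n : ℝ) ≤ k := by exact_mod_cast hk
    have h2 : 2 ≤ μ + k + 1 := by linarith
    have h3 : 1 ≤ Real.Gamma (μ + k + 1) := by
      have := Real.Gamma_strictMonoOn_Ici.monotoneOn Set.self_mem_Ici h2 h2
      rwa [Real.Gamma_two] at this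
    rw [abs_of_nonneg (by positivity)]
    exact inv_le_one_of_one_le₀ h3
  obtain ⟨M, hM⟩ := h.bddAbove_range
  exact ⟨M, fun k => hM ⟨k, rfl⟩⟩

lemma summable_besselEntire (μ x : ℝ) :
    Summable fun k : ℕ => x ^ k / (k.factorial * Real.Gamma (μ + k + 1)) := by
  obtain ⟨M, hM⟩ := exists_inv_Gamma_le μ
  refine Summable.of_norm_bounded ((Real.summable_pow_div_factorial |x|).mul_left M) fun k => ?_
  have e : x ^ k / (k.factorial * Real.Gamma (μ + k + 1))
      = (Real.Gamma (μ + k + 1))⁻¹ * (x ^ k / k.factorial) := by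
    rw [div_mul_eq_div_div, div_eq_mul_inv, mul_comm]
  rw [e, norm_mul, norm_div, norm_pow, Real.norm_eq_abs, Real.norm_eq_abs, Real.norm_natCast]
  exact mul_le_mul_of_nonneg_right (hM k) (by positivity)

lemma hasSum_besselEntire_deriv (μ x : ℝ) :
    HasSum (fun k : ℕ => k * x ^ (k - 1) / (k.factorial * Real.Gamma (μ + k + 1)))
      (besselEntire (μ + 1) x) := by
  rw [← hasSum_nat_add_iff' 1]
  simp only [Finset.range_one, Finset.sum_singleton, Nat.cast_zero, zero_mul, zero_div, sub_zero]
  have hs : HasSum _ (besselEntire (μ + 1) x) := (summable_besselEntire (μ + 1) x).hasSum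
  refine (congrArg (fun f => HasSum f _) (funext fun k => ?_)).mp hs
  symm
  have h : ((k : ℝ) + 1) ≠ 0 := by positivity
  rw [Nat.factorial_succ, Nat.add_sub_cancel]
  push_cast
  rw [show μ + (k + 1) + 1 = μ + 1 + k + 1 by ring, mul_assoc, mul_div_mul_left _ _ h]

lemma hasDerivAt_besselEntire (μ x : ℝ) :
    HasDerivAt (besselEntire μ) (besselEntire (μ + 1) x) x := by
  obtain ⟨M, hM⟩ := exists_inv_Gamma_le μ
  set R := |x| + 1
  have hu : Summable fun k : ℕ => M * (k * R ^ (k - 1) / k.factorial) := by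
    refine Summable.mul_left M ?_
    rw [← summable_nat_add_iff 1]
    refine (Real.summable_pow_div_factorial R).congr fun k => ?_
    have h : ((k : ℝ) + 1) ≠ 0 := by positivity
    rw [Nat.factorial_succ, Nat.add_sub_cancel]
    push_cast
    rw [mul_div_mul_left _ _ h]
  rw [← (hasSum_besselEntire_deriv μ x).tsum_eq]
  refine hasDerivAt_tsum_of_isPreconnected
    (g := fun (k : ℕ) y => y ^ k / (k.factorial * Real.Gamma (μ + k + 1)))
    (g' := fun (k : ℕ) y => k * y ^ (k - 1) / (k.factorial * Real.Gamma (μ + k + 1)))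
    (y₀ := x) hu Metric.isOpen_ball (convex_ball (0 : ℝ) R).isPreconnected (fun k y _ => ?_)
    (fun k y hy => ?_) ?_ (summable_besselEntire μ x) ?_
  · exact (hasDerivAt_pow k y).div_const _
  · have e : (k : ℝ) * y ^ (k - 1) / (k.factorial * Real.Gamma (μ + k + 1))
        = (Real.Gamma (μ + k + 1))⁻¹ * (k * y ^ (k - 1) / k.factorial) := by
      rw [div_mul_eq_div_div, div_eq_mul_inv, mul_comm]
    have hy' : |y| ≤ R := by
      have := mem_ball_zero_iff.1 hy
      exact this.le
    rw [e, norm_mul, norm_div, norm_mul, norm_pow, Real.norm_natCast, Real.norm_natCast,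
      Real.norm_eq_abs, Real.norm_eq_abs]
    exact mul_le_mul (hM k) (by gcongr) (by positivity) ((abs_nonneg _).trans (hM k))
  all_goals
    rw [mem_ball_zero_iff, Real.norm_eq_abs]
    exact lt_add_one _

lemma besselEntire_sub_one (μ x : ℝ) :
    besselEntire (μ - 1) x = μ * besselEntire μ x + x * besselEntire (μ + 1) x := by
  have h := ((summable_besselEntire μ x).hasSum.mul_left μ).add
    ((hasSum_besselEntire_deriv μ x).mul_left x)
  refine (h.tsum_eq.symm.trans (tsum_congr fun k => ?_)).symm
  rw [show μ - 1 + k + 1 = μ + k by ring]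
  have e : x * (k * x ^ (k - 1) / (k.factorial * Real.Gamma (μ + k + 1)))
      = k * x ^ k / (k.factorial * Real.Gamma (μ + k + 1)) := by
    rcases k with _ | k
    · simp
    · rw [Nat.add_sub_cancel, pow_succ]; ring
  rw [e]
  -- The functional equation of Γ fails at 0, but there both sides vanish thanks to the convention
  -- Γ(0) = 0.
  rcases eq_or_ne (μ + k) 0 with h0 | h0
  · rw [h0, Real.Gamma_zero, mul_zero, div_zero, mul_div_assoc (k : ℝ), ← add_mul, h0, zero_mul]
  · rw [Real.Gamma_add_one h0, mul_div_assoc (k : ℝ), ← add_mul, mul_left_comm,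
      ← mul_div_assoc, mul_div_mul_left _ _ h0]

lemma besselEntire_zero (μ : ℝ) : besselEntire μ 0 = (Real.Gamma (μ + 1))⁻¹ := by
  rw [besselEntire, tsum_eq_single 0 fun k hk => by simp [hk]]
  simp

lemma hasDerivAt_rpow_mul_besselEntire (a : ℝ) {x : ℝ} (hx : 0 < x) :
    HasDerivAt (fun x => x ^ a * besselEntire a x) (x ^ (a - 1) * besselEntire (a - 1) x) x := by
  refine ((Real.hasDerivAt_rpow_const (Or.inl hx.ne')).mul
    (hasDerivAt_besselEntire a x)).congr_deriv ?_
  rw [besselEntire_sub_one, Real.rpow_sub_one hx.ne']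
  field_simp

lemma eq_of_hasDerivAt_zero {f : ℝ → ℝ} {s : Set ℝ} (hs : IsOpen s) (hs' : IsPreconnected s)
    (hf : ∀ x ∈ s, HasDerivAt f 0 x) {x y : ℝ} (hx : x ∈ s) (hy : y ∈ s) : f x = f y :=
  hs.is_const_of_deriv_eq_zero hs'
    (fun z hz => (hf z hz).differentiableAt.differentiableWithinAt)
    (fun z hz => (hf z hz).deriv) hx hy

/-- The derivative of the left side vanishes by the recurrences and the reflection μ ↦ -μ. The
constant is read off as x → 0⁺, where only Γ(1-μ) · 1/Γ(1-μ) survives; this uses 0 < μ < 1. -/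
lemma macdonaldIntegral_wronskian {μ : ℝ} (h0 : 0 < μ) (h1 : μ < 1) {x : ℝ} (hx : 0 < x) :
    macdonaldIntegral μ x * (x ^ (1 - μ) * besselEntire (1 - μ) x)
      + macdonaldIntegral (1 - μ) x * besselEntire (-μ) x = 1 := by
  set f : ℝ → ℝ := fun x => macdonaldIntegral μ x * (x ^ (1 - μ) * besselEntire (1 - μ) x)
      + macdonaldIntegral (1 - μ) x * besselEntire (-μ) x with hf
  have hd : ∀ y ∈ Set.Ioi (0 : ℝ), HasDerivAt f 0 y := by
    intro y hy
    have hy' : 0 < y := hy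
    have e1 := macdonaldIntegral_neg (1 - μ) hy'
    have e2 := macdonaldIntegral_neg μ hy'
    have d := ((hasDerivAt_macdonaldIntegral μ hy').mul
      (hasDerivAt_rpow_mul_besselEntire (1 - μ) hy')).add
      ((hasDerivAt_macdonaldIntegral (1 - μ) hy').mul (hasDerivAt_besselEntire (-μ) y))
    refine d.congr_deriv ?_
    rw [neg_sub] at e1
    rw [sub_sub_cancel_left, e1, e2, neg_add_eq_sub μ 1]
    have e3 : y ^ (μ - 1) * y ^ (1 - μ) = 1 := by
      rw [← Real.rpow_add hy', sub_add_sub_cancel, sub_self, Real.rpow_zero]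
    linear_combination (-macdonaldIntegral (1 - μ) y * besselEntire (1 - μ) y) * e3
  have hlim : Tendsto f (𝓝[>] 0) (𝓝 1) := by
    have hc : ∀ m, Tendsto (besselEntire m) (𝓝[>] 0) (𝓝 (Real.Gamma (m + 1))⁻¹) := by
      intro m
      rw [← besselEntire_zero]
      exact ((hasDerivAt_besselEntire m 0).continuousAt.tendsto).mono_left nhdsWithin_le_nhds
    have hp : Tendsto (fun x : ℝ => x ^ (1 - μ)) (𝓝[>] 0) (𝓝 0) := by
      have := (Real.continuousAt_rpow_const 0 (1 - μ) (Or.inr (by linarith))).tendsto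
      rw [Real.zero_rpow (by linarith)] at this
      exact this.mono_left nhdsWithin_le_nhds
    have := ((tendsto_macdonaldIntegral_zero h0).mul (hp.mul (hc (1 - μ)))).add
      ((tendsto_macdonaldIntegral_zero (show 0 < 1 - μ by linarith)).mul (hc (-μ)))
    rwa [zero_mul, mul_zero, zero_add, neg_add_eq_sub,
      mul_inv_cancel₀ (Real.Gamma_pos_of_pos (by linarith)).ne'] at this
  refine tendsto_nhds_unique (tendsto_const_nhds.congr' ?_) hlim
  filter_upwards [self_mem_nhdsWithin] with y hy
  exact eq_of_hasDerivAt_zero isOpen_Ioi isPreconnected_Ioi hd hx hy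

/-- The left side is constant on ℝ, and its value at 0 is Euler's reflection formula. -/
lemma besselEntire_wronskian (μ x : ℝ) :
    besselEntire (-μ) x * besselEntire (μ - 1) x
      - x * (besselEntire (1 - μ) x * besselEntire μ x) = Real.sin (Real.pi * μ) / Real.pi := by
  set f : ℝ → ℝ := fun x => besselEntire (-μ) x * besselEntire (μ - 1) x
      - x * (besselEntire (1 - μ) x * besselEntire μ x) with hf
  have hd : ∀ y ∈ Set.univ, HasDerivAt f 0 y := by
    intro y _
    have d := ((hasDerivAt_besselEntire (-μ) y).mul (hasDerivAt_besselEntire (μ - 1) y)).sub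
      ((hasDerivAt_id y).mul
        ((hasDerivAt_besselEntire (1 - μ) y).mul (hasDerivAt_besselEntire μ y)))
    refine d.congr_deriv ?_
    have e1 := besselEntire_sub_one μ y
    have e2 := besselEntire_sub_one (1 - μ) y
    rw [sub_sub_cancel_left] at e2
    rw [e1, e2, sub_add_cancel, neg_add_eq_sub μ 1]
    simp only [id, Pi.mul_apply]
    ring
  rw [show besselEntire (-μ) x * besselEntire (μ - 1) x
      - x * (besselEntire (1 - μ) x * besselEntire μ x) = f x from rfl,
    eq_of_hasDerivAt_zero isOpen_univ isPreconnected_univ hd (Set.mem_univ x) (Set.mem_univ 0), hf]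
  simp only [besselEntire_zero, zero_mul, sub_zero, sub_add_cancel, neg_add_eq_sub]
  rw [← mul_inv, mul_comm, Real.Gamma_mul_Gamma_one_sub, inv_div]

/-- The mixed Wronskians for μ and 1 - μ are two linear equations in the Macdonald integrals of
these orders; `besselEntire_wronskian` is their determinant. -/
lemma sin_mul_macdonaldIntegral_of_mem_Ioo {μ : ℝ} (h0 : 0 < μ) (h1 : μ < 1) {x : ℝ}
    (hx : 0 < x) : Real.sin (Real.pi * μ) * macdonaldIntegral μ x
      = Real.pi * (besselEntire (-μ) x - x ^ μ * besselEntire μ x) := by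
  have w1 := macdonaldIntegral_wronskian h0 h1 hx
  have w2 := macdonaldIntegral_wronskian (show 0 < 1 - μ by linarith) (by linarith) hx
  have w3 := besselEntire_wronskian μ x
  rw [sub_sub_cancel, neg_sub] at w2
  rw [eq_div_iff Real.pi_ne_zero] at w3
  have e : x ^ μ * x ^ (1 - μ) = x := by
    rw [← Real.rpow_add hx, add_sub_cancel, Real.rpow_one]
  rw [← w3]
  linear_combination (Real.pi * besselEntire (-μ) x) * w2
    - (Real.pi * x ^ μ * besselEntire μ x) * w1
    + (Real.pi * macdonaldIntegral μ x * besselEntire (1 - μ) x * besselEntire μ x) * e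

lemma sin_mul_macdonaldIntegral_neg {μ x : ℝ} (hx : 0 < x)
    (h : Real.sin (Real.pi * μ) * macdonaldIntegral μ x
      = Real.pi * (besselEntire (-μ) x - x ^ μ * besselEntire μ x)) :
    Real.sin (Real.pi * -μ) * macdonaldIntegral (-μ) x
      = Real.pi * (besselEntire (- -μ) x - x ^ (-μ) * besselEntire (-μ) x) := by
  have e : x ^ (-μ) * x ^ μ = 1 := by
    rw [← Real.rpow_add hx, neg_add_cancel, Real.rpow_zero]
  rw [macdonaldIntegral_neg μ hx, mul_neg, Real.sin_neg, neg_neg]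
  linear_combination (-x ^ (-μ)) * h + (Real.pi * besselEntire μ x) * e

/-- The reflection formula expressing Macdonald's integral by the two Frobenius solutions. -/
lemma sin_mul_macdonaldIntegral (μ : ℝ) {x : ℝ} (hx : 0 < x) :
    Real.sin (Real.pi * μ) * macdonaldIntegral μ x
      = Real.pi * (besselEntire (-μ) x - x ^ μ * besselEntire μ x) := by
  -- The recurrence reaches order p + 1 from p and p - 1, so the induction needs a base interval of
  -- length two. Including -1 covers the case p = 0.
  have base : ∀ m : ℝ, -1 ≤ m → m < 1 → Real.sin (Real.pi * m) * macdonaldIntegral m x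
      = Real.pi * (besselEntire (-m) x - x ^ m * besselEntire m x) := by
    intro m hm hm1
    rcases hm.eq_or_lt with rfl | hm
    · have := besselEntire_sub_one 0 x
      rw [zero_sub, zero_add, zero_mul, zero_add] at this
      rw [mul_neg_one, Real.sin_neg, Real.sin_pi, neg_neg, this, Real.rpow_neg_one,
        inv_mul_cancel_left₀ hx.ne']
      simp
    rcases lt_trichotomy m 0 with h | rfl | h
    · have := sin_mul_macdonaldIntegral_neg hx
        (sin_mul_macdonaldIntegral_of_mem_Ioo (show 0 < -m by linarith) (by linarith) hx)
      simpa using this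
    · simp
    · exact sin_mul_macdonaldIntegral_of_mem_Ioo h hm1 hx
  have step : ∀ n : ℕ, ∀ m : ℝ, -1 ≤ m → m < n + 1 → Real.sin (Real.pi * m) * macdonaldIntegral m x
      = Real.pi * (besselEntire (-m) x - x ^ m * besselEntire m x) := by
    intro n
    induction n with
    | zero => intro m hm hm1; exact base m hm (by simpa using hm1)
    | succ n ih =>
      intro m hm hm1
      push_cast at hm1
      rcases lt_or_ge m 1 with h | h
      · exact base m hm h
      · obtain ⟨p, rfl⟩ : ∃ p, m = p + 1 := ⟨m - 1, by ring⟩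
        have a0 := ih p (by linarith) (by linarith)
        have a1 := ih (p - 1) (by linarith) (by linarith)
        have r := macdonaldIntegral_recurrence p hx
        have b0 := besselEntire_sub_one p x
        have b1 := besselEntire_sub_one (-p) x
        have s0 : Real.sin (Real.pi * (p + 1)) = -Real.sin (Real.pi * p) := by
          rw [mul_add, mul_one, Real.sin_add_pi]
        have s1 : Real.sin (Real.pi * (p - 1)) = -Real.sin (Real.pi * p) := by
          rw [mul_sub, mul_one, Real.sin_sub_pi]
        rw [s1, neg_sub, Real.rpow_sub_one hx.ne'] at a1
        rw [← neg_add', neg_add_eq_sub p 1] at b1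
        rw [s0, Real.rpow_add_one hx.ne', b1]
        have a1' : -Real.sin (Real.pi * p) * (x * macdonaldIntegral (p - 1) x)
            = Real.pi * (x * besselEntire (1 - p) x - x ^ p * besselEntire (p - 1) x) := by
          rw [mul_left_comm, a1]
          field_simp
        rw [b0] at a1'
        linear_combination Real.sin (Real.pi * p) * r - p * a0 + a1'
  obtain ⟨n, hn⟩ := exists_nat_gt |μ|
  rcases le_total 0 μ with h | h
  · exact step n μ (by linarith) (by linarith [le_abs_self μ])
  · have := sin_mul_macdonaldIntegral_neg hx
      (step n (-μ) (by linarith) (by linarith [neg_abs_le μ]))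
    simpa using this

lemma besselI_eq (μ : ℝ) {z : ℝ} (hz : 0 < z) :
    besselI μ z = (z / 2) ^ μ * besselEntire μ (z ^ 2 / 4) := by
  rw [besselI, besselEntire, ← tsum_mul_left]
  refine tsum_congr fun k => ?_
  have e : (2 * (k : ℝ)) = ((2 * k : ℕ) : ℝ) := by push_cast; ring
  rw [Real.rpow_add (half_pos hz), e, Real.rpow_natCast, pow_mul, div_pow]
  norm_num
  ring

lemma besselKQuot_eq {μ z : ℝ} (hz : 0 < z) (hμ : Real.sin (μ * Real.pi) ≠ 0) :
    besselKQuot μ z = (z / 2) ^ (-μ) / 2 * macdonaldIntegral μ (z ^ 2 / 4) := by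
  have h := sin_mul_macdonaldIntegral μ (x := z ^ 2 / 4) (by positivity)
  rw [mul_comm Real.pi μ] at h
  have e : (z / 2) ^ (-μ) * (z ^ 2 / 4) ^ μ = (z / 2) ^ μ := by
    rw [show z ^ 2 / 4 = (z / 2) * (z / 2) by ring, Real.mul_rpow (half_pos hz).le (half_pos hz).le,
      ← mul_assoc, ← Real.rpow_add (half_pos hz), neg_add_cancel, Real.rpow_zero, one_mul]
  rw [besselKQuot, besselI_eq _ hz, besselI_eq _ hz, ← mul_div_assoc, div_eq_iff hμ]
  linear_combination (-(z / 2) ^ (-μ) / 2) * h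
    + (Real.pi / 2 * besselEntire μ (z ^ 2 / 4)) * e

lemma besselK_eq (μ : ℝ) {z : ℝ} (hz : 0 < z) :
    besselK μ z = (z / 2) ^ (-μ) / 2 * macdonaldIntegral μ (z ^ 2 / 4) := by
  have sin_ne : ∀ s : ℝ, (∀ m : ℤ, s ≠ m) → Real.sin (s * Real.pi) ≠ 0 := by
    intro s hs h
    obtain ⟨m, hm⟩ := Real.sin_eq_zero_iff.1 h
    exact hs m (mul_right_cancel₀ Real.pi_ne_zero hm).symm
  rw [besselK]
  split_ifs with hn
  · obtain ⟨n, rfl⟩ := hn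
    refine Tendsto.limUnder_eq ?_
    have hc : Continuous fun s : ℝ => (z / 2) ^ (-s) / 2 * macdonaldIntegral s (z ^ 2 / 4) :=
      (((Real.continuous_const_rpow (half_pos hz).ne').comp continuous_neg).div_const 2).mul
        (continuous_macdonaldIntegral_order (by positivity))
    -- Within distance one of n the only integer is n itself, so the quotient formula is valid on a
    -- punctured neighbourhood.
    refine ((hc.tendsto (n : ℝ)).mono_left nhdsWithin_le_nhds).congr' ?_
    filter_upwards [self_mem_nhdsWithin, mem_nhdsWithin_of_mem_nhds
      (Ioo_mem_nhds (show (n : ℝ) - 1 < n by linarith) (show (n : ℝ) < n + 1 by linarith))]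
      with s hs hs'
    refine (besselKQuot_eq hz (sin_ne s fun m hm => hs ?_)).symm
    rw [hm] at hs' ⊢
    have l1 : n - 1 < m := by exact_mod_cast hs'.1
    have l2 : m < n + 1 := by exact_mod_cast hs'.2
    have : m = n := by omega
    rw [this]; rfl
  · push Not at hn
    exact besselKQuot_eq hz (sin_ne μ hn)

end AsymWishart

end

/-! ### Bessel weights, the sign transform, and its inversion on polynomials. -/

noncomputable section

namespace AsymWishart

lemma exists_eval_le_exp (P : Polynomial ℝ) {ε : ℝ} (hε : 0 < ε) :
    ∃ C, 0 ≤ C ∧ ∀ y, |P.eval y| ≤ C * Real.exp (ε * |y|) := by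
  refine ⟨∑ i ∈ Finset.range (P.natDegree + 1), |P.coeff i| * (i.factorial / ε ^ i),
    Finset.sum_nonneg fun i _ => by positivity, fun y => ?_⟩
  rw [Polynomial.eval_eq_sum_range, Finset.sum_mul]
  refine (Finset.abs_sum_le_sum_abs _ _).trans (Finset.sum_le_sum fun i _ => ?_)
  rw [abs_mul, mul_assoc, abs_pow]
  refine mul_le_mul_of_nonneg_left ?_ (abs_nonneg _)
  have h := Real.pow_div_factorial_le_exp (ε * |y|) (by positivity) i
  rw [div_le_iff₀ (by positivity), mul_pow] at h
  rw [div_mul_eq_mul_div, le_div_iff₀ (by positivity)]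
  linarith

lemma integrable_rpow_abs_mul_exp {r η : ℝ} (hr : -1 < r) (hη : 0 < η) :
    Integrable fun y : ℝ => |y| ^ r * Real.exp (-(η * |y|)) := by
  have h := (integrable_fun_norm_addHaar (E := ℝ) volume
    (f := fun t : ℝ => t ^ r * Real.exp (-(η * t)))).2 ?_
  · simpa only [Real.norm_eq_abs] using h
  · have := integrableOn_rpow_mul_exp_neg_mul_rpow (p := 1) (s := r) hr one_pos hη
    simpa using this

lemma tendsto_rpow_abs_mul_exp {r η : ℝ} (hη : 0 < η) :
    Tendsto (fun y : ℝ => |y| ^ r * Real.exp (-(η * |y|))) (atBot ⊔ atTop) (𝓝 0) := by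
  have h : Tendsto (fun y : ℝ => |y|) (atBot ⊔ atTop) atTop :=
    tendsto_abs_atBot_atTop.sup tendsto_abs_atTop_atTop
  have := (tendsto_rpow_mul_exp_neg_mul_atTop_nhds_zero r η hη).comp h
  simpa [Function.comp_def] using this

/-- The weight `B(μ, (b y)² / 4) e^{d y}`, where `B` is `macdonaldIntegral`. -/
def besselWeight (μ b d y : ℝ) : ℝ :=
  macdonaldIntegral μ ((b * y) ^ 2 / 4) * Real.exp (d * y)

section weight

variable {μ b d : ℝ}

lemma besselWeight_nonneg (μ b d y : ℝ) : 0 ≤ besselWeight μ b d y :=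
  mul_nonneg (macdonaldIntegral_nonneg _ _) (Real.exp_pos _).le

lemma hasDerivAt_besselWeight (μ d : ℝ) (hb : b ≠ 0) {y : ℝ} (hy : y ≠ 0) :
    HasDerivAt (besselWeight μ b d)
      (d * besselWeight μ b d y - b ^ 2 * y / 2 * besselWeight (μ - 1) b d y) y := by
  have hx : 0 < (b * y) ^ 2 / 4 := by positivity
  have hi : HasDerivAt (fun y : ℝ => (b * y) ^ 2 / 4) (b ^ 2 * y / 2) y := by
    refine ((((hasDerivAt_id y).const_mul b).pow 2).div_const 4).congr_deriv ?_
    simp only [id]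
    ring
  have he : HasDerivAt (fun y : ℝ => Real.exp (d * y)) (Real.exp (d * y) * d) y := by
    simpa using ((hasDerivAt_id y).const_mul d).exp
  refine (((hasDerivAt_macdonaldIntegral μ hx).comp y hi).mul he).congr_deriv ?_
  simp only [besselWeight, Function.comp]
  ring

lemma besselWeight_recurrence (μ d : ℝ) (hb : b ≠ 0) {y : ℝ} (hy : y ≠ 0) :
    μ * besselWeight μ b d y = besselWeight (μ + 1) b d y
      - (b * y) ^ 2 / 4 * besselWeight (μ - 1) b d y := by
  have h := macdonaldIntegral_recurrence μ (x := (b * y) ^ 2 / 4) (by positivity)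
  simp only [besselWeight]
  linear_combination Real.exp (d * y) * h

lemma continuousAt_besselWeight (μ d : ℝ) (hb : b ≠ 0) {y : ℝ} (hy : y ≠ 0) :
    ContinuousAt (besselWeight μ b d) y :=
  (hasDerivAt_besselWeight μ d hb hy).continuousAt

lemma aestronglyMeasurable_besselWeight (μ d : ℝ) (hb : b ≠ 0) :
    AEStronglyMeasurable (besselWeight μ b d) := by
  rw [← restrict_compl_singleton (μ := volume) (0 : ℝ)]
  exact ContinuousOn.aestronglyMeasurable
    (fun y hy => (continuousAt_besselWeight μ d hb hy).continuousWithinAt)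
    (measurableSet_singleton 0).compl

/-- The condition μ > -1/2 makes the singularity at 0 integrable, and |d| < b leaves exponential
decay after the drift e^{dy}. -/
lemma exists_besselWeight_mul_le (hμ : -(1 / 2) < μ) (hd : |d| < b) (P : Polynomial ℝ) :
    ∃ C r η : ℝ, -1 < r ∧ 0 < η ∧ ∀ y ≠ 0,
      |besselWeight μ b d y * P.eval y| ≤ C * (|y| ^ r * Real.exp (-(η * |y|))) := by
  have hb : 0 < b := (abs_nonneg d).trans_lt hd
  -- The witness is the midpoint of max(0, -μ) and 1/2.
  obtain ⟨a, ha0, ha1, ha2⟩ : ∃ a, 0 ≤ a ∧ a < 1 / 2 ∧ 0 < μ + a := by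
    refine ⟨max 0 (-μ) / 2 + 1 / 4, ?_, ?_, ?_⟩ <;>
      rcases le_total 0 (-μ) with h | h <;> simp only [h, max_eq_right, max_eq_left] <;> linarith
  -- With |d|/b < θ < 1 the rate θb exceeds |d|; half of the gap absorbs the polynomial, the other
  -- half remains as η.
  obtain ⟨θ, hθ1, hθ2⟩ := exists_between ((div_lt_one hb).2 hd)
  have hθ0 : 0 ≤ θ := (div_nonneg (abs_nonneg d) hb.le).trans hθ1.le
  rw [div_lt_iff₀ hb] at hθ1
  obtain ⟨C, hC, hB⟩ := exists_macdonaldIntegral_le ha0 (by linarith) ha2 hθ0 hθ2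
  set η := (θ * b - |d|) / 2 with hη
  have hη0 : 0 < η := by rw [hη]; linarith
  obtain ⟨C', hC', hP⟩ := exists_eval_le_exp P hη0
  refine ⟨C * (b ^ 2 / 4) ^ (-a) * C', -2 * a, η, by linarith, hη0, fun y hy => ?_⟩
  have h := hB ((b * y) ^ 2 / 4) (by positivity)
  have e1 : 2 * √((b * y) ^ 2 / 4) = b * |y| := by
    rw [show (b * y) ^ 2 / 4 = (b * y / 2) ^ 2 by ring, Real.sqrt_sq_eq_abs, abs_div, abs_mul,
      abs_of_pos hb, abs_two]
    ring
  have e2 : ((b * y) ^ 2 / 4) ^ (-a) = (b ^ 2 / 4) ^ (-a) * |y| ^ (-2 * a) := by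
    rw [show (b * y) ^ 2 / 4 = b ^ 2 / 4 * |y| ^ 2 by rw [sq_abs]; ring,
      Real.mul_rpow (by positivity) (by positivity), ← Real.rpow_natCast |y| 2, ← Real.rpow_mul
      (abs_nonneg y)]
    norm_num
  rw [e1, e2] at h
  have h3 : d * y ≤ |d| * |y| := by rw [← abs_mul]; exact le_abs_self _
  rw [abs_mul, abs_of_nonneg (besselWeight_nonneg μ b d y), besselWeight]
  calc macdonaldIntegral μ ((b * y) ^ 2 / 4) * Real.exp (d * y) * |P.eval y|
      ≤ C * ((b ^ 2 / 4) ^ (-a) * |y| ^ (-2 * a) * Real.exp (-(θ * (b * |y|))))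
        * Real.exp (|d| * |y|) * (C' * Real.exp (η * |y|)) := by
        gcongr
        exact hP y
    _ = C * (b ^ 2 / 4) ^ (-a) * C' * (|y| ^ (-2 * a) * (Real.exp (-(θ * (b * |y|)))
        * Real.exp (|d| * |y|) * Real.exp (η * |y|))) := by ring
    _ = _ := by
        rw [← Real.exp_add, ← Real.exp_add]
        congr 4
        rw [hη]; ring

lemma integrable_besselWeight_mul (hμ : -(1 / 2) < μ) (hd : |d| < b) (P : Polynomial ℝ) :
    Integrable fun y => besselWeight μ b d y * P.eval y := by
  have hb : 0 < b := (abs_nonneg d).trans_lt hd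
  obtain ⟨C, r, η, hr, hη, h⟩ := exists_besselWeight_mul_le hμ hd P
  refine Integrable.mono' ((integrable_rpow_abs_mul_exp hr hη).const_mul C)
    ((aestronglyMeasurable_besselWeight μ d hb.ne').mul P.continuous.aestronglyMeasurable) ?_
  filter_upwards [Measure.ae_ne volume (0 : ℝ)] with y hy using h y hy

lemma tendsto_besselWeight_mul (hμ : -(1 / 2) < μ) (hd : |d| < b) (P : Polynomial ℝ) :
    Tendsto (fun y => besselWeight μ b d y * P.eval y) (atBot ⊔ atTop) (𝓝 0) := by
  obtain ⟨C, r, η, hr, hη, h⟩ := exists_besselWeight_mul_le hμ hd P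
  refine squeeze_zero_norm' (a := fun y => C * (|y| ^ r * Real.exp (-(η * |y|)))) ?_ ?_
  · rw [eventually_sup]
    exact ⟨(eventually_ne_atBot 0).mono h, (eventually_ne_atTop 0).mono h⟩
  · simpa using (tendsto_rpow_abs_mul_exp hη).const_mul C

lemma tendsto_mul_besselWeight_zero (hμ : -(1 / 2) < μ) (hd : |d| < b) :
    Tendsto (fun y => y * besselWeight μ b d y) (𝓝[≠] 0) (𝓝 0) := by
  obtain ⟨C, r, η, hr, hη, h⟩ := exists_besselWeight_mul_le hμ hd 1
  refine squeeze_zero_norm' (a := fun y => C * (|y| ^ (r + 1) * Real.exp (-(η * |y|)))) ?_ ?_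
  · filter_upwards [self_mem_nhdsWithin] with y hy
    have hy' : 0 < |y| := abs_pos.2 hy
    have := h y hy
    rw [Polynomial.eval_one, mul_one] at this
    rw [norm_mul, Real.norm_eq_abs, Real.norm_eq_abs, Real.rpow_add_one hy'.ne']
    calc |y| * |besselWeight μ b d y| ≤ |y| * (C * (|y| ^ r * Real.exp (-(η * |y|)))) := by gcongr
      _ = _ := by ring
  · have hc : ContinuousAt (fun y : ℝ => C * (|y| ^ (r + 1) * Real.exp (-(η * |y|)))) 0 := by
      refine continuousAt_const.mul (ContinuousAt.mul ?_ (by fun_prop))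
      exact continuousAt_id.abs.rpow_const (Or.inr (by linarith))
    have := hc.tendsto
    rw [abs_zero, Real.zero_rpow (by linarith), zero_mul, mul_zero] at this
    exact this.mono_left nhdsWithin_le_nhds

lemma tendsto_besselWeight_zero (hμ : 0 < μ) (hb : b ≠ 0) :
    Tendsto (besselWeight μ b d) (𝓝[≠] 0) (𝓝 (Real.Gamma μ)) := by
  have h1 : Tendsto (fun y : ℝ => (b * y) ^ 2 / 4) (𝓝[≠] 0) (𝓝[>] 0) := by
    refine tendsto_nhdsWithin_of_tendsto_nhds_of_eventually_within _ ?_ ?_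
    · have : ContinuousAt (fun y : ℝ => (b * y) ^ 2 / 4) 0 := by fun_prop
      simpa using this.tendsto.mono_left (nhdsWithin_le_nhds (s := {0}ᶜ))
    · filter_upwards [self_mem_nhdsWithin] with y hy
      have : y ≠ 0 := hy
      exact Set.mem_Ioi.2 (by positivity)
  have h2 : Tendsto (fun y : ℝ => Real.exp (d * y)) (𝓝[≠] 0) (𝓝 1) := by
    have : ContinuousAt (fun y : ℝ => Real.exp (d * y)) 0 := by fun_prop
    simpa using this.tendsto.mono_left (nhdsWithin_le_nhds (s := {0}ᶜ))
  simpa [Function.comp_def] using! ((tendsto_macdonaldIntegral_zero hμ).comp h1).mul h2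

end weight

/-- The transform `f ↦ ∫ sgn(y - v) f(v) dv`. -/
def signTransform (f : ℝ → ℝ) (y : ℝ) : ℝ := ∫ v, Real.sign (y - v) * f v

lemma measurable_sign_real : Measurable Real.sign := by
  unfold Real.sign
  exact Measurable.ite measurableSet_Iio measurable_const
    (Measurable.ite measurableSet_Ioi measurable_const measurable_const)

lemma integrable_sign_mul {f : ℝ → ℝ} (hf : Integrable f) (y : ℝ) :
    Integrable fun v => Real.sign (y - v) * f v := by
  refine hf.bdd_mul (c := 1)
    (measurable_sign_real.comp (measurable_const.sub measurable_id)).aestronglyMeasurable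
    (Eventually.of_forall fun v => ?_)
  rcases Real.sign_apply_eq (y - v) with h | h | h <;> simp [h]

lemma signTransform_eq_sub {f : ℝ → ℝ} (hf : Integrable f) (y : ℝ) :
    signTransform f y = (∫ v in Set.Iic y, f v) - ∫ v in Set.Ioi y, f v := by
  have h := integrable_sign_mul hf y
  rw [signTransform, ← intervalIntegral.integral_Iic_add_Ioi (b := y) h.integrableOn
    h.integrableOn, integral_Iic_eq_integral_Iio, integral_Iic_eq_integral_Iio, sub_eq_add_neg,
    ← integral_neg]
  congr 1
  · refine setIntegral_congr_fun measurableSet_Iio fun v hv => ?_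
    have hv' : v < y := hv
    simp only [Real.sign_of_pos (sub_pos.2 hv'), one_mul]
  · refine setIntegral_congr_fun measurableSet_Ioi fun v hv => ?_
    have hv' : y < v := hv
    simp only [Real.sign_of_neg (sub_neg.2 hv'), neg_one_mul]

lemma signTransform_eq_Iic {f : ℝ → ℝ} (hf : Integrable f) (y : ℝ) :
    signTransform f y = 2 * (∫ v in Set.Iic y, f v) - ∫ v, f v := by
  rw [signTransform_eq_sub hf, ← intervalIntegral.integral_Iic_add_Ioi (b := y) hf.integrableOn
    hf.integrableOn]
  ring

lemma signTransform_eq_Ioi {f : ℝ → ℝ} (hf : Integrable f) (y : ℝ) :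
    signTransform f y = -(2 * (∫ v in Set.Ioi y, f v) - ∫ v, f v) := by
  rw [signTransform_eq_sub hf, ← intervalIntegral.integral_Iic_add_Ioi (b := y) hf.integrableOn
    hf.integrableOn]
  ring

lemma tendsto_signTransform_atTop {f : ℝ → ℝ} (hf : Integrable f) :
    Tendsto (signTransform f) atTop (𝓝 (∫ v, f v)) := by
  have h := (aecover_Iic (μ := volume) (tendsto_id (α := ℝ)
    (x := atTop))).integral_tendsto_of_countably_generated hf
  have h2 := (h.const_mul 2).sub_const (∫ v, f v)
  rw [two_mul, add_sub_cancel_right] at h2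
  exact h2.congr fun y => (signTransform_eq_Iic hf y).symm

lemma tendsto_signTransform_atBot {f : ℝ → ℝ} (hf : Integrable f) :
    Tendsto (signTransform f) atBot (𝓝 (-∫ v, f v)) := by
  have h := (aecover_Ioi (μ := volume) (tendsto_id (α := ℝ)
    (x := atBot))).integral_tendsto_of_countably_generated hf
  have h2 := ((h.const_mul 2).sub_const (∫ v, f v)).neg
  rw [two_mul, add_sub_cancel_right] at h2
  exact h2.congr fun y => (signTransform_eq_Ioi hf y).symm

lemma signTransform_eq_interval {f : ℝ → ℝ} (hf : Integrable f) (y : ℝ) :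
    signTransform f y = 2 * (∫ v in (0 : ℝ)..y, f v) + signTransform f 0 := by
  rw [signTransform_eq_Iic hf y, signTransform_eq_Iic hf 0,
    ← intervalIntegral.integral_Iic_sub_Iic hf.integrableOn hf.integrableOn]
  ring

lemma continuous_signTransform {f : ℝ → ℝ} (hf : Integrable f) :
    Continuous (signTransform f) := by
  rw [funext (signTransform_eq_interval hf)]
  exact ((intervalIntegral.continuous_primitive (fun a b => hf.intervalIntegrable) 0).const_mul
    2).add_const _

lemma hasDerivAt_signTransform {f : ℝ → ℝ} (hf : Integrable f) {y : ℝ} (hy : ContinuousAt f y) :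
    HasDerivAt (signTransform f) (2 * f y) y := by
  rw [funext (signTransform_eq_interval hf)]
  exact ((intervalIntegral.integral_hasDerivAt_right hf.intervalIntegrable
    hf.aestronglyMeasurable.stronglyMeasurableAtFilter hy).const_mul 2).add_const _

/-- A function with vanishing derivative off `0`, a limit at `0`, and opposite limits at `±∞`
vanishes off `0`. -/
lemma eq_zero_of_hasDerivAt_zero {F : ℝ → ℝ} {L M : ℝ} (hF : ∀ y ≠ 0, HasDerivAt F 0 y)
    (h0 : Tendsto F (𝓝[≠] 0) (𝓝 L)) (htop : Tendsto F atTop (𝓝 M))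
    (hbot : Tendsto F atBot (𝓝 (-M))) {y : ℝ} (hy : y ≠ 0) : F y = 0 := by
  have pos : ∀ a b : ℝ, 0 < a → 0 < b → F a = F b := fun a b ha hb =>
    eq_of_hasDerivAt_zero isOpen_Ioi isPreconnected_Ioi
      (fun z (hz : 0 < z) => hF z hz.ne') (Set.mem_Ioi.2 ha) (Set.mem_Ioi.2 hb)
  have neg : ∀ a b : ℝ, a < 0 → b < 0 → F a = F b := fun a b ha hb =>
    eq_of_hasDerivAt_zero isOpen_Iio isPreconnected_Iio
      (fun z (hz : z < 0) => hF z hz.ne) (Set.mem_Iio.2 ha) (Set.mem_Iio.2 hb)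
  have p1 : F 1 = M := tendsto_nhds_unique (tendsto_const_nhds.congr' (by
    filter_upwards [eventually_gt_atTop 0] with z hz using pos 1 z one_pos hz)) htop
  have n1 : F (-1) = -M := tendsto_nhds_unique (tendsto_const_nhds.congr' (by
    filter_upwards [eventually_lt_atBot 0] with z hz using neg (-1) z (by norm_num) hz)) hbot
  have p2 : F 1 = L := tendsto_nhds_unique (tendsto_const_nhds.congr' (by
    filter_upwards [self_mem_nhdsWithin] with z hz using pos 1 z one_pos hz))
    (h0.mono_left (nhdsWithin_mono (s := Set.Ioi 0) 0 fun z (hz : 0 < z) => hz.ne'))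
  have n2 : F (-1) = L := tendsto_nhds_unique (tendsto_const_nhds.congr' (by
    filter_upwards [self_mem_nhdsWithin] with z hz using neg (-1) z (by norm_num) hz))
    (h0.mono_left (nhdsWithin_mono (s := Set.Iio 0) 0 fun z (hz : z < 0) => hz.ne))
  -- The common limit at 0 forces M = L = -M, hence both constants vanish.
  rcases lt_or_gt_of_ne hy with h | h
  · rw [neg y (-1) h (by norm_num)]; linarith
  · rw [pos y 1 h one_pos]; linarith

open Polynomial in
/-- The differential operator which the transform `f ↦ ∫ sgn(y - v) W(v) f(v) dv`, for `W` a
Bessel weight, inverts up to a first-order operator. -/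
def weightOp (μ b d : ℝ) (k : ℝ[X]) : ℝ[X] :=
  (C ((1 + 2 * μ) * d) - C (b ^ 2 - d ^ 2) * X) * k
    + (C (1 + 2 * μ) + C (2 * d) * X) * derivative k + X * derivative (derivative k)

/-- The boundary term of the transform of `weightOp μ b d k`. -/
def weightBoundary (μ b d : ℝ) (k : Polynomial ℝ) (y : ℝ) : ℝ :=
  (d * y * besselWeight μ b d y + 2 * besselWeight (μ + 1) b d y) * k.eval y
    + y * besselWeight μ b d y * k.derivative.eval y

/-- The weights of orders μ + 1 and μ - 1 enter the derivative only in the combination that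
`besselWeight_recurrence` turns into μ times the weight itself. -/
lemma hasDerivAt_weightBoundary (μ d : ℝ) {b : ℝ} (hb : b ≠ 0) (k : Polynomial ℝ) {y : ℝ}
    (hy : y ≠ 0) : HasDerivAt (weightBoundary μ b d k)
      (besselWeight μ b d y * (weightOp μ b d k).eval y) y := by
  have w0 := hasDerivAt_besselWeight μ d hb hy
  have w1 := hasDerivAt_besselWeight (μ + 1) d hb hy
  have r := besselWeight_recurrence μ d hb hy
  have hid := hasDerivAt_id y
  have h := (((((hid.const_mul d).mul w0).add (w1.const_mul 2)).mul (k.hasDerivAt y)).add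
    ((hid.mul w0).mul (k.derivative.hasDerivAt y)))
  refine h.congr_deriv ?_
  simp only [weightOp, Polynomial.eval_add, Polynomial.eval_mul, Polynomial.eval_sub,
    Polynomial.eval_C, Polynomial.eval_X, id, add_sub_cancel_right, Pi.mul_apply, Pi.add_apply]
  linear_combination (-2 * d * k.eval y - 2 * k.derivative.eval y) * r

lemma tendsto_weightBoundary_infinity {μ b d : ℝ} (hμ : -(1 / 2) < μ) (hd : |d| < b)
    (k : Polynomial ℝ) : Tendsto (weightBoundary μ b d k) (atBot ⊔ atTop) (𝓝 0) := by
  have h1 := tendsto_besselWeight_mul hμ hd (Polynomial.C d * Polynomial.X * k)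
  have h2 := tendsto_besselWeight_mul (show -(1 / 2) < μ + 1 by linarith) hd (2 * k)
  have h3 := tendsto_besselWeight_mul hμ hd (Polynomial.X * k.derivative)
  have h := (h1.add h2).add h3
  simp only [add_zero] at h
  refine h.congr fun y => ?_
  simp only [weightBoundary, Polynomial.eval_mul, Polynomial.eval_C, Polynomial.eval_X,
    Polynomial.eval_ofNat]
  ring

/-- What matters is that the limit is the same from both sides, even where the weight itself is
unbounded. -/
lemma tendsto_weightBoundary_zero {μ b d : ℝ} (hμ : -(1 / 2) < μ) (hd : |d| < b)
    (k : Polynomial ℝ) : Tendsto (weightBoundary μ b d k) (𝓝[≠] 0)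
      (𝓝 (2 * Real.Gamma (μ + 1) * k.eval 0)) := by
  have hb : 0 < b := (abs_nonneg d).trans_lt hd
  have h1 := tendsto_mul_besselWeight_zero hμ hd
  have h2 := tendsto_besselWeight_zero (d := d) (show 0 < μ + 1 by linarith) hb.ne'
  have hk : ∀ P : Polynomial ℝ, Tendsto (fun y => P.eval y) (𝓝[≠] 0) (𝓝 (P.eval 0)) :=
    fun P => P.continuousAt.tendsto.mono_left nhdsWithin_le_nhds
  have h := (((h1.const_mul d).add (h2.const_mul 2)).mul (hk k)).add (h1.mul (hk k.derivative))
  simp only [mul_zero, zero_add, zero_mul, add_zero] at h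
  refine h.congr fun y => ?_
  simp only [weightBoundary]
  ring

/-- Off 0 both sides have the same derivative. Their difference has a two-sided limit at 0 and
opposite limits at ±∞, so `eq_zero_of_hasDerivAt_zero` applies. -/
theorem signTransform_weightOp {μ b d : ℝ} (hμ : -(1 / 2) < μ) (hd : |d| < b)
    (k : Polynomial ℝ) {y : ℝ} (hy : y ≠ 0) :
    signTransform (fun v => besselWeight μ b d v * (weightOp μ b d k).eval v) y
      = 2 * weightBoundary μ b d k y := by
  have hb : 0 < b := (abs_nonneg d).trans_lt hd
  have hint := integrable_besselWeight_mul hμ hd (weightOp μ b d k)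
  have hinf := tendsto_weightBoundary_infinity hμ hd k
  rw [tendsto_sup] at hinf
  rw [← sub_eq_zero]
  refine eq_zero_of_hasDerivAt_zero (F := fun y =>
    signTransform (fun v => besselWeight μ b d v * (weightOp μ b d k).eval v) y
      - 2 * weightBoundary μ b d k y) (fun z hz => ?_)
    (((continuous_signTransform hint).continuousAt.tendsto.mono_left nhdsWithin_le_nhds).sub
      ((tendsto_weightBoundary_zero hμ hd k).const_mul 2))
    (M := ∫ v, besselWeight μ b d v * (weightOp μ b d k).eval v) ?_ ?_ hy
  · have := (hasDerivAt_signTransform hint ((continuousAt_besselWeight μ d hb.ne' hz).mul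
      (Polynomial.continuousAt _))).sub ((hasDerivAt_weightBoundary μ d hb.ne' k hz).const_mul 2)
    exact this.congr_deriv (sub_self _)
  · simpa using (tendsto_signTransform_atTop hint).sub (hinf.2.const_mul 2)
  · simpa using (tendsto_signTransform_atBot hint).sub (hinf.1.const_mul 2)

end AsymWishart

end

/-! ### Laguerre polynomials and the action of the operator on them. -/

noncomputable section

namespace AsymWishart

open Polynomial

/-- The coefficients of the generalised Laguerre polynomials. -/
def laguerreCoeff (ν : ℝ) (j k : ℕ) : ℝ :=
  if k ≤ j then
    Real.Gamma (j + ν + 1) / ((j - k).factorial * Real.Gamma (ν + k + 1)) * ((-1) ^ k / k.factorial)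
  else 0

/-- The generalised Laguerre polynomial as an element of `ℝ[X]`. -/
def laguerrePoly (ν : ℝ) (j : ℕ) : ℝ[X] :=
  ∑ k ∈ Finset.range (j + 1), C (laguerreCoeff ν j k) * X ^ k

lemma eval_laguerrePoly (ν : ℝ) (j : ℕ) (z : ℝ) : (laguerrePoly ν j).eval z = laguerre ν j z := by
  rw [laguerrePoly, laguerre, eval_finsetSum]
  refine Finset.sum_congr rfl fun k hk => ?_
  have hk' : k ≤ j := Nat.lt_succ_iff.1 (Finset.mem_range.1 hk)
  rw [eval_mul, eval_C, eval_pow, eval_X, laguerreCoeff, if_pos hk', neg_pow z]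
  ring

lemma coeff_laguerrePoly (ν : ℝ) (j k : ℕ) :
    (laguerrePoly ν j).coeff k = laguerreCoeff ν j k := by
  simp only [laguerrePoly, finsetSum_coeff, coeff_C_mul, coeff_X_pow, mul_ite, mul_one, mul_zero]
  rw [Finset.sum_ite_eq]
  split_ifs with h
  · rfl
  · rw [laguerreCoeff, if_neg]
    simpa [Nat.lt_succ_iff] using h

section laguerre

variable {ν : ℝ}

lemma laguerrePoly_zero (hν : -1 < ν) : laguerrePoly ν 0 = 1 := by
  have h : Real.Gamma (ν + 1) ≠ 0 := (Real.Gamma_pos_of_pos (by linarith)).ne'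
  simp [laguerrePoly, laguerreCoeff, h]

lemma laguerrePoly_one (hν : -1 < ν) : laguerrePoly ν 1 = C (1 + ν) - X := by
  have h : Real.Gamma (ν + 1) ≠ 0 := (Real.Gamma_pos_of_pos (by linarith)).ne'
  have h2 : Real.Gamma (1 + ν + 1) = (1 + ν) * Real.Gamma (ν + 1) := by
    rw [Real.Gamma_add_one (by linarith), add_comm 1 ν]
  have h3 : ν + 1 ≠ 0 := by linarith
  have c0 : laguerreCoeff ν 1 0 = 1 + ν := by
    simp [laguerreCoeff, h2, h]
  have c1 : laguerreCoeff ν 1 1 = -1 := by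
    simp only [laguerreCoeff, le_refl, if_true, Nat.cast_one, Nat.sub_self, Nat.factorial,
      add_comm ν 1, h2]
    rw [add_comm 1 ν] at *
    field_simp
    simp
  simp [laguerrePoly, Finset.sum_range_succ, c0, c1, sub_eq_add_neg]

/-- Together with `derivative_laguerrePoly_succ`, this relation supplies both the second-order
equation and the three-term recurrence used below. -/
lemma X_mul_derivative_laguerrePoly (hν : -1 < ν) (j : ℕ) :
    X * derivative (laguerrePoly ν (j + 1))
      = C ((j : ℝ) + 1) * laguerrePoly ν (j + 1) - C ((j : ℝ) + 1 + ν) * laguerrePoly ν j := by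
  ext k
  have e : (X * derivative (laguerrePoly ν (j + 1))).coeff k
      = k * laguerreCoeff ν (j + 1) k := by
    rcases k with _ | k
    · simp
    · rw [coeff_X_mul, coeff_derivative, coeff_laguerrePoly]
      push_cast
      ring
  rw [e, coeff_sub, coeff_C_mul, coeff_C_mul, coeff_laguerrePoly, coeff_laguerrePoly]
  rcases lt_trichotomy k (j + 1) with h | rfl | h
  · obtain ⟨m, rfl⟩ := Nat.exists_eq_add_of_le (Nat.lt_succ_iff.1 h)
    have hG : Real.Gamma (ν + k + 1) ≠ 0 :=
      (Real.Gamma_pos_of_pos (by have : (0 : ℝ) ≤ k := k.cast_nonneg; linarith)).ne'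
    have hp : ((k : ℝ) + m + ν + 1) ≠ 0 := by
      have h1 : (0 : ℝ) ≤ k := k.cast_nonneg
      have h2 : (0 : ℝ) ≤ m := m.cast_nonneg
      linarith
    have g1 : Real.Gamma ((k : ℝ) + m + 1 + ν + 1)
        = (k + m + ν + 1) * Real.Gamma (k + m + ν + 1) := by
      rw [← Real.Gamma_add_one hp]; ring_nf
    rw [laguerreCoeff, laguerreCoeff, if_pos (by omega), if_pos (by omega),
      show k + m + 1 - k = m + 1 by omega, show k + m - k = m by omega, Nat.factorial_succ]
    push_cast
    rw [g1]
    field_simp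
    ring
  · rw [laguerreCoeff, laguerreCoeff, if_neg (show ¬ j + 1 ≤ j by omega)]
    push_cast
    ring
  · rw [laguerreCoeff, laguerreCoeff, if_neg (by omega), if_neg (by omega)]
    ring

lemma derivative_laguerrePoly_succ (hν : -1 < ν) (j : ℕ) :
    derivative (laguerrePoly ν (j + 1))
      = derivative (laguerrePoly ν j) - laguerrePoly ν j := by
  ext k
  rw [coeff_sub, coeff_derivative, coeff_derivative, coeff_laguerrePoly, coeff_laguerrePoly,
    coeff_laguerrePoly]
  have hk0 : (0 : ℝ) ≤ k := k.cast_nonneg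
  have hp : ν + k + 1 ≠ 0 := by linarith
  have hG : Real.Gamma (ν + k + 1) ≠ 0 := (Real.Gamma_pos_of_pos (by linarith)).ne'
  have g0 : Real.Gamma (ν + (k + 1) + 1) = (ν + k + 1) * Real.Gamma (ν + k + 1) := by
    rw [← Real.Gamma_add_one hp]; ring_nf
  rcases lt_trichotomy k j with h | rfl | h
  · obtain ⟨m, rfl⟩ := Nat.exists_eq_add_of_lt h
    have hq : ((k : ℝ) + m + 1 + ν + 1) ≠ 0 := by
      have h2 : (0 : ℝ) ≤ m := m.cast_nonneg
      linarith
    have g1 : Real.Gamma ((k : ℝ) + m + 1 + 1 + ν + 1)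
        = (k + m + 1 + ν + 1) * Real.Gamma (k + m + 1 + ν + 1) := by
      rw [← Real.Gamma_add_one hq]; ring_nf
    rw [laguerreCoeff, laguerreCoeff, laguerreCoeff, if_pos (by omega), if_pos (by omega),
      if_pos (by omega), show k + m + 1 + 1 - (k + 1) = m + 1 by omega,
      show k + m + 1 - (k + 1) = m by omega, show k + m + 1 - k = m + 1 by omega,
      Nat.factorial_succ, Nat.factorial_succ]
    push_cast
    rw [g0, g1, pow_succ]
    field_simp
    ring
  · have g2 : Real.Gamma ((k : ℝ) + 1 + ν + 1) = (ν + k + 1) * Real.Gamma (ν + k + 1) := by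
      rw [← Real.Gamma_add_one hp]; ring_nf
    have g3 : Real.Gamma ((k : ℝ) + ν + 1) = Real.Gamma (ν + k + 1) := by ring_nf
    rw [laguerreCoeff, laguerreCoeff, laguerreCoeff, if_pos (by omega), if_neg (by omega),
      if_pos (by omega), Nat.sub_self, Nat.sub_self, Nat.factorial_succ]
    push_cast
    rw [g0, g2, g3, pow_succ]
    field_simp
    simp
  · rw [laguerreCoeff, laguerreCoeff, laguerreCoeff, if_neg (by omega), if_neg (by omega),
      if_neg (by omega)]
    ring

/-- The rescaled polynomial `L_j^{(ν)}(X / τ)`. -/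
def scaledLaguerre (ν τ : ℝ) (j : ℕ) : ℝ[X] := (laguerrePoly ν j).comp (C τ⁻¹ * X)

lemma eval_scaledLaguerre (ν τ : ℝ) (j : ℕ) (y : ℝ) :
    (scaledLaguerre ν τ j).eval y = laguerre ν j (y / τ) := by
  simp [scaledLaguerre, eval_laguerrePoly, div_eq_inv_mul]

variable {τ : ℝ}

lemma one_sub_sq_pos (h0 : 0 < τ) (h1 : τ < 1) : 0 < 1 - τ ^ 2 := by nlinarith

lemma eval_weightOp_scaledLaguerre_zero (hν : -1 < ν) (h0 : 0 < τ) (h1 : τ < 1) (y : ℝ) :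
    (weightOp (ν / 2) (1 - τ ^ 2)⁻¹ (τ * (1 - τ ^ 2)⁻¹) (scaledLaguerre ν τ 0)).eval y
      = (1 - τ ^ 2)⁻¹ * (τ * laguerre ν 1 (y / τ)) := by
  have h := (one_sub_sq_pos h0 h1).ne'
  rw [← eval_laguerrePoly, laguerrePoly_one hν, scaledLaguerre, laguerrePoly_zero hν, weightOp]
  simp
  field_simp

/-- For these parameters b² - d² = b. The differential equation, the formula for sL' and the
three-term recurrence reduce everything to neighbouring polynomials, and the coefficient of L_{j+1}
cancels. -/
lemma eval_weightOp_scaledLaguerre_succ (hν : -1 < ν) (h0 : 0 < τ) (h1 : τ < 1) (j : ℕ) (y : ℝ) :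
    (weightOp (ν / 2) (1 - τ ^ 2)⁻¹ (τ * (1 - τ ^ 2)⁻¹) (scaledLaguerre ν τ (j + 1))).eval y
      = (1 - τ ^ 2)⁻¹ * (τ * (j + 2) * laguerre ν (j + 2) (y / τ)
        - τ⁻¹ * (j + 1 + ν) * laguerre ν j (y / τ)) := by
  have h := (one_sub_sq_pos h0 h1).ne'
  have r1 := X_mul_derivative_laguerrePoly hν j
  have r1' := congrArg derivative r1
  have r2 := X_mul_derivative_laguerrePoly hν (j + 1)
  have r3 := derivative_laguerrePoly_succ hν j
  have r4 := derivative_laguerrePoly_succ hν (j + 1)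
  have s1 := congrArg (eval (τ⁻¹ * y)) r1
  have s1' := congrArg (eval (τ⁻¹ * y)) r1'
  have s2 := congrArg (eval (τ⁻¹ * y)) r2
  have s3 := congrArg (eval (τ⁻¹ * y)) r3
  have s4 := congrArg (eval (τ⁻¹ * y)) r4
  simp only [derivative_mul, derivative_sub, derivative_X, derivative_C, eval_add, eval_mul,
    eval_sub, eval_C, eval_X, zero_mul, one_mul, zero_add, Nat.cast_add, Nat.cast_one]
    at s1 s1' s2 s3 s4
  simp only [weightOp, scaledLaguerre, derivative_comp, derivative_mul, derivative_X, derivative_C,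
    eval_add, eval_mul, eval_sub, eval_C, eval_X, eval_comp, zero_mul, mul_one, zero_add]
  rw [show y / τ = τ⁻¹ * y by rw [div_eq_inv_mul], ← eval_laguerrePoly, ← eval_laguerrePoly]
  obtain ⟨s, rfl⟩ : ∃ s, y = τ * s := ⟨τ⁻¹ * y, by field_simp⟩
  rw [inv_mul_cancel_left₀ h0.ne'] at *
  have hb : (1 - τ ^ 2)⁻¹ * (1 - τ ^ 2) = 1 := inv_mul_cancel₀ h
  have ht : τ⁻¹ * τ = 1 := inv_mul_cancel₀ h0.ne'
  generalize (1 - τ ^ 2)⁻¹ = b at *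
  generalize τ⁻¹ = t at *
  set A := eval s (laguerrePoly ν j)
  set B := eval s (laguerrePoly ν (j + 1))
  set B1 := eval s (derivative (laguerrePoly ν (j + 1)))
  set B2 := eval s (derivative (derivative (laguerrePoly ν (j + 1))))
  -- `E1` is the Laguerre differential equation, `E2` the three-term recurrence.
  have E1 : s * B2 + (1 + ν) * B1 = -((j + 1 + ν) * A) := by
    linear_combination s1' + (j + 1 + ν) * s3
  have E2 : s * B = (j + 1) * B - (j + 1 + ν) * A - (j + 2) * eval s (laguerrePoly ν (j + 2))
      + (j + 2 + ν) * B := by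
    linear_combination s1 - s2 + s * s4
  linear_combination t * E1 + 2 * b * τ * s1 - b * τ * E2
    + (s * t * B2 + 2 * b * τ * s * B1 + b * τ * (j + 1 + ν) * A) * ht
    + (t * (j + 1 + ν) * A - b * τ * s * B) * hb

end laguerre

end AsymWishart

end

/-! ### Telescoping of the operator along the kernel. -/

noncomputable section

namespace AsymWishart

open Polynomial

/-- `kernelC N ν τ x` as a polynomial. -/
def kernelCPoly (N : ℕ) (ν τ x : ℝ) : ℝ[X] :=
  ∑ j ∈ Finset.range N,
    (j.factorial * τ ^ (2 * j) / Real.Gamma (j + ν + 1) * laguerre ν j (x / τ))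
      • scaledLaguerre ν τ j

lemma eval_kernelCPoly (N : ℕ) (ν τ x y : ℝ) :
    (kernelCPoly N ν τ x).eval y = kernelC N ν τ x y := by
  simp [kernelCPoly, kernelC, eval_finsetSum, eval_scaledLaguerre]

/-- `pEven ν τ j` as a polynomial. -/
def pEvenPoly (ν τ : ℝ) (j : ℕ) : ℝ[X] :=
  (τ ^ (2 * j) * (2 * j).factorial) • scaledLaguerre ν τ (2 * j)

/-- `pOdd ν τ j` as a polynomial. -/
def pOddPoly (ν τ : ℝ) (j : ℕ) : ℝ[X] :=
  (-τ ^ (2 * j + 1) * (2 * j + 1).factorial) • scaledLaguerre ν τ (2 * j + 1)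
    + if j = 0 then 0 else
        (τ ^ (2 * j - 1) * (2 * j).factorial * (2 * j + ν)) • scaledLaguerre ν τ (2 * j - 1)

lemma eval_pEvenPoly (ν τ : ℝ) (j : ℕ) (y : ℝ) : (pEvenPoly ν τ j).eval y = pEven ν τ j y := by
  simp [pEvenPoly, pEven, eval_scaledLaguerre]

lemma eval_pOddPoly (ν τ : ℝ) (j : ℕ) (y : ℝ) : (pOddPoly ν τ j).eval y = pOdd ν τ j y := by
  rw [pOddPoly, pOdd, eval_add]
  split_ifs <;> simp [eval_scaledLaguerre]

lemma weightOp_add (μ b d : ℝ) (p q : ℝ[X]) :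
    weightOp μ b d (p + q) = weightOp μ b d p + weightOp μ b d q := by
  simp only [weightOp, derivative_add]; ring

lemma weightOp_smul (μ b d a : ℝ) (p : ℝ[X]) :
    weightOp μ b d (a • p) = a • weightOp μ b d p := by
  simp only [weightOp, smul_eq_C_mul, derivative_C_mul]; ring

/-- The skew-orthogonal sum of `kernelS`, with the transform in the second variable removed. -/
def preKernelPoly (n : ℕ) (ν τ x : ℝ) : ℝ[X] :=
  ∑ j ∈ Finset.range n, ((pOdd ν τ j x / skewNorm ν τ j) • pEvenPoly ν τ j
    - (pEven ν τ j x / skewNorm ν τ j) • pOddPoly ν τ j)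

/-- The coefficient of the boundary term in `weightOp_kernelCPoly`. -/
def boundaryCoeff (n : ℕ) (ν τ x : ℝ) : ℝ :=
  (1 - τ ^ 2)⁻¹ * τ ^ (4 * n + 1) * (2 * n + 1).factorial / Real.Gamma (2 * n + 1 + ν)
    * laguerre ν (2 * n + 1) (x / τ)

/-- With c_j = j! τ^{2j}/Γ(j+ν+1) one has τ⁻¹(j+1+ν)c_{j+1} = τ(j+1)c_j, so neighbour terms pair
antisymmetrically, leaving L_{2n+1}(x)L_{2n}(y). Each p_{2j} is paired with both of its odd
neighbours inside p_{2j+1}, so the induction advances two indices at a time. -/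
lemma eval_weightOp_kernelCPoly {ν τ : ℝ} (hν : -1 < ν) (h0 : 0 < τ) (h1 : τ < 1) (n : ℕ)
    (x y : ℝ) :
    (weightOp (ν / 2) (1 - τ ^ 2)⁻¹ (τ * (1 - τ ^ 2)⁻¹) (kernelCPoly (2 * n + 1) ν τ x)).eval y
      = 2 * Real.pi * (preKernelPoly (n + 1) ν τ x).eval y
        + boundaryCoeff n ν τ x * laguerre ν (2 * n) (y / τ) := by
  have h := (one_sub_sq_pos h0 h1).ne'
  have hpi := Real.pi_ne_zero
  induction n with
  | zero =>
    have hG : Real.Gamma (1 + ν) ≠ 0 := (Real.Gamma_pos_of_pos (by linarith)).ne'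
    rw [kernelCPoly, preKernelPoly]
    simp only [mul_zero, zero_add, Finset.range_one, Finset.sum_singleton, weightOp_smul,
      eval_smul, smul_eq_mul, eval_sub, eval_pEvenPoly, eval_pOddPoly,
      eval_weightOp_scaledLaguerre_zero hν h0 h1]
    rw [pOdd, pEven, pOdd, pEven, boundaryCoeff, skewNorm]
    simp [add_comm ν 1]
    generalize laguerre ν 0 (x / τ) = X0
    generalize laguerre ν 0 (y / τ) = Y0
    generalize laguerre ν 1 (x / τ) = X1
    generalize laguerre ν 1 (y / τ) = Y1
    field_simp
    ring
  | succ n ih =>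
    have hn : (0 : ℝ) ≤ n := n.cast_nonneg
    set G := Real.Gamma (2 * n + 1 + ν) with hGd
    have hG : G ≠ 0 := (Real.Gamma_pos_of_pos (by linarith)).ne'
    have hp1 : 2 * (n : ℝ) + 1 + ν ≠ 0 := by linarith
    have hp2 : 2 * (n : ℝ) + 2 + ν ≠ 0 := by linarith
    have g1 : Real.Gamma (2 * n + 1 + ν + 1) = (2 * n + 1 + ν) * G := Real.Gamma_add_one hp1
    have g2 : Real.Gamma (2 * (n + 1) + 1 + ν) = (2 * n + 2 + ν) * ((2 * n + 1 + ν) * G) := by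
      rw [← g1, show 2 * ((n : ℝ) + 1) + 1 + ν = (2 * n + 2 + ν) + 1 by ring,
        Real.Gamma_add_one hp2]
      ring_nf
    have g3 : Real.Gamma (2 * (n + 1) + ν + 1) = (2 * n + 2 + ν) * ((2 * n + 1 + ν) * G) := by
      rw [← g2]; ring_nf
    have g4 : Real.Gamma (2 * ((n : ℝ) + 1) + 1) = (2 * n + 2).factorial := by
      rw [← Real.Gamma_nat_eq_factorial]; push_cast; ring_nf
    rw [kernelCPoly, show 2 * (n + 1) + 1 = 2 * n + 1 + 1 + 1 by ring, Finset.sum_range_succ,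
      Finset.sum_range_succ, ← kernelCPoly, preKernelPoly, Finset.sum_range_succ, ← preKernelPoly]
    simp only [weightOp_add, weightOp_smul, eval_add, eval_smul, smul_eq_mul, eval_sub,
      eval_pEvenPoly, eval_pOddPoly, ih, eval_weightOp_scaledLaguerre_succ hν h0 h1]
    rw [pOdd, pEven, pOdd, pEven, boundaryCoeff, boundaryCoeff, skewNorm, if_neg n.succ_ne_zero,
      if_neg n.succ_ne_zero]
    rw [show 2 * (n + 1) + 1 = 2 * n + 3 by ring, show 2 * (n + 1) - 1 = 2 * n + 1 by omega,
      show 2 * (n + 1) = 2 * n + 2 by ring, show 2 * n + 1 + 1 = 2 * n + 2 by ring,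
      show 2 * n + 1 + 2 = 2 * n + 3 by ring]
    push_cast
    rw [g2, g4, ← hGd, show 2 * (n : ℝ) + 2 + ν + 1 = 2 * (n + 1) + ν + 1 by ring, g3, g1]
    generalize laguerre ν (2 * n) (x / τ) = X0
    generalize laguerre ν (2 * n) (y / τ) = Y0
    generalize laguerre ν (2 * n + 1) (x / τ) = X1
    generalize laguerre ν (2 * n + 1) (y / τ) = Y1
    generalize laguerre ν (2 * n + 2) (x / τ) = X2
    generalize laguerre ν (2 * n + 2) (y / τ) = Y2
    generalize laguerre ν (2 * n + 3) (x / τ) = X3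
    generalize laguerre ν (2 * n + 3) (y / τ) = Y3
    generalize (preKernelPoly (n + 1) ν τ x).eval y = S
    rw [Nat.factorial_succ (2 * n + 2), Nat.factorial_succ (2 * n + 1)]
    have hf : ((2 * n + 1).factorial : ℝ) ≠ 0 := Nat.cast_ne_zero.2 (Nat.factorial_ne_zero _)
    push_cast
    generalize ((2 * n + 1).factorial : ℝ) = f at *
    have hn2 : 2 * (n : ℝ) + 2 ≠ 0 := by linarith
    have hp3 : 2 * ((n : ℝ) + 1) + ν ≠ 0 := by linarith
    field_simp
    ring

end AsymWishart

end

/-! ### Return to Bessel functions and assembly of the decomposition. -/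

noncomputable section

namespace AsymWishart

/-- The transform `P ↦ ∫ sgn(y - v) W(v) P(v) dv`, for `W` a Bessel weight, on polynomials. -/
def weightTransform {μ b d : ℝ} (hμ : -(1 / 2) < μ) (hd : |d| < b) (y : ℝ) :
    Polynomial ℝ →ₗ[ℝ] ℝ where
  toFun P := signTransform (fun v => besselWeight μ b d v * P.eval v) y
  map_add' P Q := by
    rw [signTransform, signTransform, signTransform,
      ← integral_add (integrable_sign_mul (integrable_besselWeight_mul hμ hd P) y)
        (integrable_sign_mul (integrable_besselWeight_mul hμ hd Q) y)]
    congr with v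
    rw [Polynomial.eval_add]
    ring
  map_smul' a P := by
    rw [signTransform, signTransform, RingHom.id_apply, smul_eq_mul, ← integral_const_mul]
    congr with v
    rw [Polynomial.eval_smul, smul_eq_mul]
    ring

lemma abs_rpow_mul_besselK (μ : ℝ) {b y : ℝ} (hb : 0 < b) (hy : y ≠ 0) :
    |y| ^ μ * besselK μ (|y| * b)
      = (b / 2) ^ (-μ) / 2 * macdonaldIntegral μ ((b * y) ^ 2 / 4) := by
  have hy' : 0 < |y| := abs_pos.2 hy
  have e : |y| ^ μ * |y| ^ (-μ) = 1 := by
    rw [← Real.rpow_add hy', add_neg_cancel, Real.rpow_zero]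
  rw [besselK_eq μ (mul_pos hy' hb), mul_pow, sq_abs, mul_comm (y ^ 2), ← mul_pow,
    show |y| * b / 2 = |y| * (b / 2) by ring, Real.mul_rpow hy'.le (half_pos hb).le]
  linear_combination ((b / 2) ^ (-μ) / 2 * macdonaldIntegral μ ((b * y) ^ 2 / 4)) * e

section kernel

variable {ν τ : ℝ}

/-- The constant relating the Bessel weight to `|y|^{ν/2} K_{ν/2}(|y|/(1-τ²)) e^{τ y/(1-τ²)}`. -/
def weightConst (ν τ : ℝ) : ℝ := ((1 - τ ^ 2)⁻¹ / 2) ^ (-(ν / 2)) / 2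

lemma weight_eq (h0 : 0 < τ) (h1 : τ < 1) {y : ℝ} (hy : y ≠ 0) :
    |y| ^ (ν / 2) * besselK (ν / 2) (|y| / (1 - τ ^ 2)) * Real.exp (τ * y / (1 - τ ^ 2))
      = weightConst ν τ * besselWeight (ν / 2) (1 - τ ^ 2)⁻¹ (τ * (1 - τ ^ 2)⁻¹) y := by
  rw [div_eq_mul_inv |y|, abs_rpow_mul_besselK _ (inv_pos.2 (one_sub_sq_pos h0 h1)) hy,
    besselWeight, weightConst, show τ * y / (1 - τ ^ 2) = τ * (1 - τ ^ 2)⁻¹ * y by ring]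
  ring

lemma weight_succ_eq (h0 : 0 < τ) (h1 : τ < 1) {y : ℝ} (hy : y ≠ 0) :
    |y| ^ (ν / 2) * (|y| * besselK (ν / 2 + 1) (|y| / (1 - τ ^ 2)))
        * Real.exp (τ * y / (1 - τ ^ 2))
      = weightConst ν τ * (2 * (1 - τ ^ 2)
        * besselWeight (ν / 2 + 1) (1 - τ ^ 2)⁻¹ (τ * (1 - τ ^ 2)⁻¹) y) := by
  have hb := inv_pos.2 (one_sub_sq_pos h0 h1)
  have h := abs_rpow_mul_besselK (ν / 2 + 1) hb hy
  rw [Real.rpow_add_one (abs_pos.2 hy).ne', neg_add, Real.rpow_add (half_pos hb),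
    Real.rpow_neg_one, inv_div, div_inv_eq_mul] at h
  rw [div_eq_mul_inv |y|, besselWeight, weightConst,
    show τ * y / (1 - τ ^ 2) = τ * (1 - τ ^ 2)⁻¹ * y by ring]
  linear_combination Real.exp (τ * (1 - τ ^ 2)⁻¹ * y) * h

lemma neg_half_lt (hν : -1 < ν) : -(1 / 2) < ν / 2 := by linarith

lemma abs_drift_lt (h0 : 0 < τ) (h1 : τ < 1) : |τ * (1 - τ ^ 2)⁻¹| < (1 - τ ^ 2)⁻¹ := by
  have hb := inv_pos.2 (one_sub_sq_pos h0 h1)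
  rw [abs_of_pos (by positivity)]
  exact mul_lt_of_lt_one_left hb h1

lemma phiIntegrand_ae_eq (h0 : 0 < τ) (h1 : τ < 1) (p : ℝ → ℝ) (y : ℝ) :
    phiIntegrand ν τ p y =ᵐ[volume] fun v => weightConst ν τ * (Real.sign (y - v)
      * (besselWeight (ν / 2) (1 - τ ^ 2)⁻¹ (τ * (1 - τ ^ 2)⁻¹) v * p v)) := by
  filter_upwards [Measure.ae_ne volume (0 : ℝ)] with v hv
  rw [phiIntegrand]
  linear_combination (Real.sign (y - v) * p v) * weight_eq (ν := ν) h0 h1 hv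

/-- Off v = y the factor 1/2 - 1_{v<y} equals -sgn(y-v)/2, so S_{N,2} involves the same sign
transform as Φ_j. -/
lemma kernelS2Integrand_ae_eq (h0 : 0 < τ) (h1 : τ < 1) (N : ℕ) (y : ℝ) :
    kernelS2Integrand N ν τ y =ᵐ[volume] fun v => -weightConst ν τ / 2 * (Real.sign (y - v)
      * (besselWeight (ν / 2) (1 - τ ^ 2)⁻¹ (τ * (1 - τ ^ 2)⁻¹) v
        * (scaledLaguerre ν τ (N - 2)).eval v)) := by
  filter_upwards [Measure.ae_ne volume (0 : ℝ), Measure.ae_ne volume y] with v hv hvy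
  have e : 1 / 2 - (Set.Iio y).indicator (fun _ => (1 : ℝ)) v = -Real.sign (y - v) / 2 := by
    rcases lt_or_gt_of_ne hvy with h | h
    · rw [Set.indicator_of_mem (Set.mem_Iio.2 h), Real.sign_of_pos (sub_pos.2 h)]; norm_num
    · rw [Set.indicator_of_notMem (by simpa using h.le), Real.sign_of_neg (sub_neg.2 h)]; norm_num
  rw [kernelS2Integrand, e, eval_scaledLaguerre,
    show τ / (1 - τ ^ 2) * v = τ * v / (1 - τ ^ 2) by ring]
  linear_combination (-Real.sign (y - v) / 2 * laguerre ν (N - 2) (v / τ))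
    * weight_eq (ν := ν) h0 h1 hv

lemma integrable_phiIntegrand (hν : -1 < ν) (h0 : 0 < τ) (h1 : τ < 1)
    (P : Polynomial ℝ) (y : ℝ) :
    Integrable (phiIntegrand ν τ (fun v => P.eval v) y) :=
  ((integrable_sign_mul (integrable_besselWeight_mul (neg_half_lt hν) (abs_drift_lt h0 h1) P)
    y).const_mul _).congr (phiIntegrand_ae_eq h0 h1 _ y).symm

lemma integral_phiIntegrand (hν : -1 < ν) (h0 : 0 < τ) (h1 : τ < 1)
    (P : Polynomial ℝ) (y : ℝ) :
    ∫ v, phiIntegrand ν τ (fun v => P.eval v) y v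
      = weightConst ν τ * weightTransform (neg_half_lt hν) (abs_drift_lt h0 h1) y P := by
  rw [integral_congr_ae (phiIntegrand_ae_eq h0 h1 _ y), integral_const_mul]
  rfl

lemma integrable_kernelS2Integrand (hν : -1 < ν) (h0 : 0 < τ) (h1 : τ < 1)
    (N : ℕ) (y : ℝ) : Integrable (kernelS2Integrand N ν τ y) :=
  ((integrable_sign_mul (integrable_besselWeight_mul (neg_half_lt hν) (abs_drift_lt h0 h1) _)
    y).const_mul _).congr (kernelS2Integrand_ae_eq h0 h1 N y).symm

lemma integral_kernelS2Integrand (hν : -1 < ν) (h0 : 0 < τ) (h1 : τ < 1)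
    (N : ℕ) (y : ℝ) :
    ∫ v, kernelS2Integrand N ν τ y v = -weightConst ν τ / 2
      * weightTransform (neg_half_lt hν) (abs_drift_lt h0 h1) y (scaledLaguerre ν τ (N - 2)) := by
  rw [integral_congr_ae (kernelS2Integrand_ae_eq h0 h1 N y), integral_const_mul]
  rfl

lemma kernelS_eq (hν : -1 < ν) (h0 : 0 < τ) (h1 : τ < 1)
    (n : ℕ) (x y : ℝ) :
    kernelS (2 * n + 2) ν τ x y
      = |x| ^ (ν / 2) * besselK (ν / 2) (|x| / (1 - τ ^ 2)) * Real.exp (τ * x / (1 - τ ^ 2))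
        * (weightConst ν τ * weightTransform (neg_half_lt hν) (abs_drift_lt h0 h1) y
          (preKernelPoly (n + 1) ν τ x)) := by
  rw [kernelS, preKernelPoly,
    map_sum (weightTransform (neg_half_lt hν) (abs_drift_lt h0 h1) y),
    show (2 * n + 2) / 2 = n + 1 by omega]
  congr 1
  rw [Finset.mul_sum]
  refine Finset.sum_congr rfl fun j _ => ?_
  have e1 : phiEven ν τ j y = weightConst ν τ
      * weightTransform (neg_half_lt hν) (abs_drift_lt h0 h1) y (pEvenPoly ν τ j) := by
    rw [phiEven, ← funext (eval_pEvenPoly ν τ j)]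
    exact integral_phiIntegrand hν h0 h1 _ y
  have e2 : phiOdd ν τ j y = weightConst ν τ
      * weightTransform (neg_half_lt hν) (abs_drift_lt h0 h1) y (pOddPoly ν τ j) := by
    rw [phiOdd, ← funext (eval_pOddPoly ν τ j)]
    exact integral_phiIntegrand hν h0 h1 _ y
  rw [map_sub, map_smul, map_smul, e1, e2, smul_eq_mul, smul_eq_mul]
  ring

/-- Transform the polynomial identity of `eval_weightOp_kernelCPoly` and evaluate one side by
`signTransform_weightOp`. -/
lemma weightTransform_preKernelPoly (hν : -1 < ν) (h0 : 0 < τ) (h1 : τ < 1)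
    (n : ℕ) (x : ℝ) {y : ℝ} (hy : y ≠ 0) :
    2 * Real.pi * weightTransform (neg_half_lt hν) (abs_drift_lt h0 h1) y
        (preKernelPoly (n + 1) ν τ x)
      + boundaryCoeff n ν τ x * weightTransform (neg_half_lt hν) (abs_drift_lt h0 h1) y
        (scaledLaguerre ν τ (2 * n))
      = 2 * weightBoundary (ν / 2) (1 - τ ^ 2)⁻¹ (τ * (1 - τ ^ 2)⁻¹)
        (kernelCPoly (2 * n + 1) ν τ x) y := by
  rw [← signTransform_weightOp (neg_half_lt hν) (abs_drift_lt h0 h1) _ hy]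
  have e : weightOp (ν / 2) (1 - τ ^ 2)⁻¹ (τ * (1 - τ ^ 2)⁻¹) (kernelCPoly (2 * n + 1) ν τ x)
      = (2 * Real.pi) • preKernelPoly (n + 1) ν τ x
        + boundaryCoeff n ν τ x • scaledLaguerre ν τ (2 * n) := by
    refine Polynomial.funext fun z => ?_
    rw [eval_weightOp_kernelCPoly hν h0 h1, Polynomial.eval_add, Polynomial.eval_smul,
      Polynomial.eval_smul, eval_scaledLaguerre, smul_eq_mul, smul_eq_mul]
  have := congrArg (weightTransform (neg_half_lt hν) (abs_drift_lt h0 h1) y) e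
  rw [map_add, map_smul, map_smul, smul_eq_mul, smul_eq_mul] at this
  exact this.symm

lemma kernelS_decomposition (hν : -1 < ν) (h0 : 0 < τ) (h1 : τ < 1)
    (n : ℕ) {x y : ℝ} (hy : y ≠ 0) :
    kernelS (2 * n + 2) ν τ x y = kernelS1 (2 * n + 2) ν τ x y
      + kernelS1Tilde (2 * n + 2) ν τ x y + kernelS2 (2 * n + 2) ν τ x y := by
  have hpi := Real.pi_ne_zero
  have h := (one_sub_sq_pos h0 h1).ne'
  have w0 := weight_eq (ν := ν) h0 h1 hy
  have w1 := weight_succ_eq (ν := ν) h0 h1 hy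
  have t := weightTransform_preKernelPoly hν h0 h1 n x hy
  have hder : deriv (fun s => kernelC (2 * n + 2 - 1) ν τ x s) y
      = (kernelCPoly (2 * n + 1) ν τ x).derivative.eval y := by
    rw [show 2 * n + 2 - 1 = 2 * n + 1 by omega, ← funext (eval_kernelCPoly (2 * n + 1) ν τ x)]
    exact Polynomial.deriv _
  have hx : |x * y| ^ (ν / 2) = |x| ^ (ν / 2) * |y| ^ (ν / 2) := by
    rw [abs_mul, Real.mul_rpow (abs_nonneg x) (abs_nonneg y)]
  rw [kernelS_eq hν h0 h1, kernelS1, kernelS1Tilde, kernelS2, hder,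
    integral_kernelS2Integrand hν h0 h1, hx, mul_add (τ / (1 - τ ^ 2)) x y, Real.exp_add,
    show 2 * n + 2 - 2 = 2 * n by omega, show 2 * n + 2 - 1 = 2 * n + 1 by omega,
    show 2 * (2 * n + 2) - 3 = 4 * n + 1 by omega, ← eval_kernelCPoly,
    show τ / (1 - τ ^ 2) * x = τ * x / (1 - τ ^ 2) by ring,
    show τ / (1 - τ ^ 2) * y = τ * y / (1 - τ ^ 2) by ring]
  rw [boundaryCoeff, weightBoundary] at t
  push_cast
  rw [show 2 * (n : ℝ) + 2 + ν - 1 = 2 * n + 1 + ν by ring]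
  set T := weightTransform (neg_half_lt hν) (abs_drift_lt h0 h1) y (preKernelPoly (n + 1) ν τ x)
  set T' := weightTransform (neg_half_lt hν) (abs_drift_lt h0 h1) y (scaledLaguerre ν τ (2 * n))
  set k0 := (kernelCPoly (2 * n + 1) ν τ x).eval y
  set k1 := (kernelCPoly (2 * n + 1) ν τ x).derivative.eval y
  have hb : (1 - τ ^ 2)⁻¹ * (1 - τ ^ 2) = 1 := inv_mul_cancel₀ h
  have hp : Real.pi⁻¹ * Real.pi = 1 := inv_mul_cancel₀ hpi
  simp only [div_eq_mul_inv, one_mul] at *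
  generalize (1 - τ ^ 2)⁻¹ = b at *
  generalize Real.pi⁻¹ = q at *
  generalize |x| ^ (ν * 2⁻¹) = a at *
  generalize besselK (ν * 2⁻¹) (|x| * b) = K at *
  generalize Real.exp (τ * x * b) = E at *
  generalize besselWeight (ν * 2⁻¹ + 1) b (τ * b) y = W at *
  -- `t` is the transformed identity; `w0` and `w1` turn the weights of orders ν/2 and ν/2 + 1 back
  -- into Bessel functions.
  linear_combination (a * K * E * weightConst ν τ * q / 2) * t
    - (a * K * E * q * (b * τ * y * k0 + y * k1)) * w0 - (a * K * E * q * b * k0) * w1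
    - (a * K * E * weightConst ν τ * T) * hp - (2 * a * K * E * weightConst ν τ * q * W * k0) * hb

lemma continuous_kernelS (hν : -1 < ν) (h0 : 0 < τ) (h1 : τ < 1)
    (n : ℕ) (x : ℝ) : Continuous (kernelS (2 * n + 2) ν τ x) := by
  rw [funext (kernelS_eq hν h0 h1 n x)]
  exact continuous_const.mul (continuous_const.mul (continuous_signTransform
    (integrable_besselWeight_mul (neg_half_lt hν) (abs_drift_lt h0 h1) _)))

end kernel

end AsymWishart

end

open AsymWishart in
theorem theorem2p1 (N : ℕ) (hN : Even N) (hN2 : 2 ≤ N) (τ : ℝ) (hτ : τ ∈ Set.Ioo (0 : ℝ) 1)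
    (ν : ℝ) (hν : -1 < ν) :
    -- all integrals in the definitions converge absolutely
    (∀ y : ℝ,
      (∀ j : ℕ, Integrable (phiIntegrand ν τ (pEven ν τ j) y) ∧
        Integrable (phiIntegrand ν τ (pOdd ν τ j) y)) ∧
      Integrable (kernelS2Integrand N ν τ y)) ∧
    -- the decomposition
    (∀ x y : ℝ, x ≠ 0 → y ≠ 0 →
      kernelS N ν τ x y
        = kernelS1 N ν τ x y + kernelS1Tilde N ν τ x y + kernelS2 N ν τ x y) ∧
    -- at `y = 0`, where the Bessel factors in `y` are singular, it holds as a limit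
    (∀ x : ℝ, x ≠ 0 →
      Tendsto (fun y => kernelS1 N ν τ x y + kernelS1Tilde N ν τ x y + kernelS2 N ν τ x y)
        (𝓝[≠] 0) (𝓝 (kernelS N ν τ x 0))) := by
  obtain ⟨h0, h1⟩ := hτ
  obtain ⟨n, rfl⟩ : ∃ n, N = 2 * n + 2 := by
    obtain ⟨m, rfl⟩ := hN
    exact ⟨m - 1, by omega⟩
  refine ⟨fun y => ⟨fun j => ⟨?_, ?_⟩, integrable_kernelS2Integrand hν h0 h1 _ y⟩,
    fun x y _ hy => kernelS_decomposition hν h0 h1 n hy, fun x _ => ?_⟩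
  · rw [← funext (eval_pEvenPoly ν τ j)]
    exact integrable_phiIntegrand hν h0 h1 _ y
  · rw [← funext (eval_pOddPoly ν τ j)]
    exact integrable_phiIntegrand hν h0 h1 _ y
  -- The terms on the right may be singular separately, but for y ≠ 0 their sum is S_N, which is
  -- continuous in y.
  · refine ((continuous_kernelS hν h0 h1 n x).continuousAt.tendsto.mono_left
      nhdsWithin_le_nhds).congr' ?_
    filter_upwards [self_mem_nhdsWithin] with y hy
    exact kernelS_decomposition hν h0 h1 n hy
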